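/- Let $N\ge 1$ be an integer, $\mathbf R^N$ the Euclidean space, $B(z,\sigma)$ the open ball, and let $G(t,x)=(4\pi t)^{-N/2}e^{-|x|^2/(4t)}$ and $e^{t\Delta}\mu(x)=\int_{\mathbf R^N}G(t,x-y)\,d\mu(y)$ for $t>0$. For $0<\alpha<1$ let $$h_\alpha(\theta)=\sum_{k=0}^\infty\frac{(-\theta)^k}{k!\,\Gamma(1-\alpha-\alpha k)},\qquad \theta>0$$ (with $1/\Gamma=0$ at the poles of $\Gamma$), which is the probability density on $(0,\infty)$ with Laplace transform $\int_0^\infty h_\alpha(\theta)e^{-s\theta}\,d\theta=\sum_{k\ge0}(-s)^k/\Gamma(1+\alpha k)$, and set $$P_\alpha(t)\mu=\int_0^\infty h_\alpha(\theta)\,e^{t^\alpha\theta\Delta}\mu\,d\theta,\qquad S_\alpha(t)\mu=\int_0^\infty \theta h_\alpha(\theta)\,e^{t^\alpha\theta\Delta}\mu\,d\theta .$$ For $p>1$, $0<T<\infty$ and a nonnegative Radon measure $\mu$ on $\mathbf R^N$, a nonnegative solution in $[0,T]\times\mathbf R^N$ of the problem $$\partial_t^\alpha u-\Delta u=u^p,\qquad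 u(0)=\mu,$$ where $\partial_t^\alpha$ is the Caputo derivative, is a measurable function $u:(0,T]\times\mathbf R^N\to[0,\infty]$ such that $$\infty>u(t,x)=[P_\alpha(t)\mu](x)+\alpha\int_0^t(t-s)^{\alpha-1}[S_\alpha(t-s)u(s)^p](x)\,ds$$ for almost all $t\in(0,T]$ and $x\in\mathbf R^N$ (a function $\phi$ being identified with the measure $\phi\,dx$). (1) For every $p>1$ there are constants $\gamma_1(\alpha)=\gamma_1(N,p,\alpha)>0$, $0<\alpha<1$, with $\limsup_{\alpha\to1-0}\gamma_1(\alpha)\in(0,\infty)$, such that for all $\alpha\in(0,1)$, $T\in(0,\infty)$ and all nonnegative Radon measures $\mu$ for which the problem has a nonnegative solution in $[0,T]\times\mathbf R^N$, $$\sup_{z\in\mathbf R^N}\mu(B(z,\sigma))\le\gamma_1(\alpha)\,\sigma^{N-\frac2{p-1}}\qquad\text{for all }\sigma\in(0,T^{\alpha/2}].$$ (2) Let $p=p_F:=1+2/N$. There are constants $\gamma_1'(\alpha)=\gamma_1'(N,\alpha)>0$, $0<\alpha<1$, with $\limsup_{\alpha\to1-0}\gamma_1'(\alpha)\in(0,\infty)$,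 such that for all $\alpha\in(0,1)$, $T\in(0,\infty)$ and all nonnegative Radon measures $\mu$ for which the problem has a nonnegative solution in $[0,T]\times\mathbf R^N$, $$\sup_{z\in\mathbf R^N}\mu(B(z,\sigma))\le\gamma_1'(\alpha)\left(\int_{\sigma^{2/\alpha}/(16T)}^{1/4}t^{-\alpha}\,dt\right)^{-\frac N2}\qquad\text{for all }\sigma\in(0,T^{\alpha/2}].$$ -/

import Mathlib

open MeasureTheory Set Filter Topology
open scoped ENNReal

namespace TimeFractional

noncomputable section

/-- The Gauss kernel `G(t,x) = (4πt)^{-N/2} exp(-|x|²/(4t))` on `ℝ^N`. -/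
def heatKernel (N : ℕ) (t : ℝ) (x : EuclideanSpace ℝ (Fin N)) : ℝ :=
  (4 * Real.pi * t) ^ (-((N : ℝ) / 2)) * Real.exp (-(‖x‖ ^ 2 / (4 * t)))

/-- `e^{tΔ} μ (x) = ∫ G(t, x - y) dμ(y)`, with values in `[0,∞]`. -/
def heatSemigroup {N : ℕ} (t : ℝ) (μ : Measure (EuclideanSpace ℝ (Fin N)))
    (x : EuclideanSpace ℝ (Fin N)) : ℝ≥0∞ :=
  ∫⁻ y, ENNReal.ofReal (heatKernel N t (x - y)) ∂μ

/-- The probability density `h_α` on `(0,∞)` (the Wright, or Mainardi, function)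
`h_α(θ) = ∑_{k ≥ 0} (-θ)^k / (k! Γ(1 - α - αk))`, whose Laplace transform is the
Mittag-Leffler function `E_{α,1}(-s)`. As usual `1/Γ` vanishes at the poles of `Γ`; this agrees
with `Real.Gamma` being `0` there and division by `0` being `0`. -/
def wrightDensity (α θ : ℝ) : ℝ :=
  ∑' k : ℕ, (-θ) ^ k / ((k.factorial : ℝ) * Real.Gamma (1 - α - α * k))

/-- `P_α(t) μ = ∫_0^∞ h_α(θ) e^{t^α θ Δ} μ dθ`. -/
def opP {N : ℕ} (α t : ℝ) (μ : Measure (EuclideanSpace ℝ (Fin N)))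
    (x : EuclideanSpace ℝ (Fin N)) : ℝ≥0∞ :=
  ∫⁻ θ in Ioi (0 : ℝ), ENNReal.ofReal (wrightDensity α θ) * heatSemigroup (t ^ α * θ) μ x

/-- `S_α(t) μ = ∫_0^∞ θ h_α(θ) e^{t^α θ Δ} μ dθ`. -/
def opS {N : ℕ} (α t : ℝ) (μ : Measure (EuclideanSpace ℝ (Fin N)))
    (x : EuclideanSpace ℝ (Fin N)) : ℝ≥0∞ :=
  ∫⁻ θ in Ioi (0 : ℝ), ENNReal.ofReal (θ * wrightDensity α θ) * heatSemigroup (t ^ α * θ) μ x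

/-- `u` is a nonnegative solution in `[0,T] × ℝ^N` of `∂_t^α u - Δu = u^p`, `u(0) = μ`:
`u` is a Lebesgue measurable `[0,∞]`-valued function on `(0,T] × ℝ^N` that is finite and satisfies
`u(t) = P_α(t)μ + α ∫_0^t (t-s)^{α-1} S_α(t-s) u(s)^p ds` almost everywhere.
The function `u(s)^p` is identified with the measure `u(s,y)^p dy`. -/
structure IsSolution {N : ℕ} (α p T : ℝ) (μ : Measure (EuclideanSpace ℝ (Fin N)))
    (u : ℝ → EuclideanSpace ℝ (Fin N) → ℝ≥0∞) : Prop where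
  aemeasurable : AEMeasurable (Function.uncurry u)
    ((volume.restrict (Ioc (0 : ℝ) T)).prod volume)
  finite : ∀ᵐ t ∂(volume.restrict (Ioc (0 : ℝ) T)), ∀ᵐ x, u t x < ∞
  eq : ∀ᵐ t ∂(volume.restrict (Ioc (0 : ℝ) T)), ∀ᵐ x,
    u t x = opP α t μ x + ENNReal.ofReal α *
      ∫⁻ s in Ioo (0 : ℝ) t, ENNReal.ofReal ((t - s) ^ (α - 1)) *
        opS α (t - s) (volume.withDensity fun y => u s y ^ p) x

/-- The Fujita exponent `p_F = 1 + 2/N`. -/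
def fujitaExponent (N : ℕ) : ℝ := 1 + 2 / (N : ℝ)

end

end TimeFractional

/-!
As `α → 1` the density `h_α` concentrates at `θ = 1`: it is `2 / α` times the real part of the
Fourier transform of `exp((2πiξ)^{1/α})` on the half-line `ξ > 0`, and these functions converge to
`exp(2πiξ)`, whose transform is singular only at `1`. Hence both `P_α(t)μ` and `α S_α(t)μ` dominate
`g t^{-αN/2} μ(B(x, 4t^{α/2}))`, with one constant `g` for all `α` near `1`.

A lower bound for a solution feeds back through the Duhamel term: after a while `A` can be replaced
by `2A`, and the time needed, measured by a suitable clock, is proportional to a negative power of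
`A`. Infinitely many doublings therefore fit into a finite time if `A` is large at the start, which
the finiteness of the solution forbids. On a fixed parabolic cylinder, with `A` of the order of
`σ^{-N} μ(B(z, σ))` and with the ordinary time as the clock, this gives the first bound. For
`p = 1 + 2/N` the profile `A t^{-αN/2}` on `|x - z| < t^{α/2}` reproduces itself with the
clock `t ↦ (1 - (τ/t)^{1-α}) / (1 - α)`, which amounts to the integral of `t^{-α}` in the second
bound.
-/

namespace TimeFractional

noncomputable section

open scoped FourierTransform Real
open Complex (I)
open ProbabilityTheory (complexMGF analyticOnNhd_complexMGF integrableExpSet)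

section GammaIntegral

lemma eqOn_re_pos_of_forall_ofReal {f g : ℂ → ℂ} (hf : AnalyticOnNhd ℂ f {z | 0 < z.re})
    (hg : AnalyticOnNhd ℂ g {z | 0 < z.re}) (h : ∀ s : ℝ, 0 < s → f s = g s) :
    EqOn f g {z | 0 < z.re} := by
  have htend : Tendsto (fun s : ℝ => (s : ℂ)) (𝓝[>] 1) (𝓝[≠] 1) := by
    refine tendsto_nhdsWithin_iff.2
      ⟨(Complex.continuous_ofReal.tendsto' 1 1 Complex.ofReal_one).mono_left nhdsWithin_le_nhds, ?_⟩
    filter_upwards [self_mem_nhdsWithin] with s hs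
    simpa using (mem_Ioi.1 hs).ne'
  refine hf.eqOn_of_preconnected_of_frequently_eq hg (convex_halfSpace_re_gt 0).isPreconnected
    (by simp) (htend.frequently (Eventually.frequently ?_))
  filter_upwards [self_mem_nhdsWithin] with s hs
  exact h s (one_pos.trans hs)

/-- By analytic continuation from `r > 0`; the left side is the moment generating function of
`-t` under `t^(a-1) dt`. -/
lemma integral_rpow_mul_cexp_neg_mul_Ioi {a : ℝ} (ha : 0 < a) {r : ℂ} (hr : 0 < r.re) :
    ∫ t in Ioi (0 : ℝ), ((t ^ (a - 1) : ℝ) : ℂ) * Complex.exp (-(r * t)) =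
      (1 / r) ^ (a : ℂ) * Real.Gamma a := by
  set μ : Measure ℝ := (volume.restrict (Ioi 0)).withDensity fun t => ENNReal.ofReal (t ^ (a - 1))
    with hμ
  have hmgf (z : ℂ) : complexMGF Neg.neg μ z =
      ∫ t in Ioi (0 : ℝ), ((t ^ (a - 1) : ℝ) : ℂ) * Complex.exp (-(z * t)) := by
    rw [complexMGF, hμ, integral_withDensity_eq_integral_toReal_smul (by fun_prop)
      (Eventually.of_forall fun _ => ENNReal.ofReal_lt_top)]
    refine setIntegral_congr_fun measurableSet_Ioi fun t ht => ?_
    simp [ENNReal.toReal_ofReal (Real.rpow_nonneg (mem_Ioi.1 ht).le (a - 1))]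
  have hexp : Ioi (0 : ℝ) ⊆ integrableExpSet Neg.neg μ := fun s hs => by
    rw [integrableExpSet, mem_ofPred_eq, hμ, integrable_withDensity_iff (by fun_prop)
      (Eventually.of_forall fun _ => ENNReal.ofReal_lt_top)]
    refine (integrableOn_rpow_mul_exp_neg_mul_rpow (p := 1) (s := a - 1) (by linarith) one_pos
      hs).congr_fun (fun t ht => ?_) measurableSet_Ioi
    simp [ENNReal.toReal_ofReal (Real.rpow_nonneg (mem_Ioi.1 ht).le (a - 1)), mul_comm]
  have hright : AnalyticOnNhd ℂ (fun z : ℂ => (1 / z) ^ (a : ℂ) * Real.Gamma a)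
      {z | 0 < z.re} := by
    refine DifferentiableOn.analyticOnNhd (fun z (hz : 0 < z.re) => ?_)
      (isOpen_lt continuous_const Complex.continuous_re)
    have hz0 : z ≠ 0 := Complex.slitPlane_ne_zero (Or.inl hz)
    have hslit : 1 / z ∈ Complex.slitPlane := by
      refine Or.inl ?_
      rw [one_div, Complex.inv_re]
      exact div_pos hz (Complex.normSq_pos.2 hz0)
    have : DifferentiableAt ℂ (fun z : ℂ => (1 / z) ^ (a : ℂ) * Real.Gamma a) z := by
      fun_prop (disch := assumption)
    exact this.differentiableWithinAt
  rw [← hmgf]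
  refine eqOn_re_pos_of_forall_ofReal (analyticOnNhd_complexMGF.mono
    fun z hz => interior_maximal hexp isOpen_Ioi hz) hright (fun s hs => ?_) hr
  rw [hmgf, ← Complex.Gamma_ofReal,
    ← Complex.integral_cpow_mul_exp_neg_mul_Ioi (a := (a : ℂ)) (by simpa using ha) hs]
  refine setIntegral_congr_fun measurableSet_Ioi fun t ht => ?_
  rw [Complex.ofReal_cpow (mem_Ioi.1 ht).le]
  push_cast
  rfl

end GammaIntegral

section WrightSymbol

/-- The function `exp((2πiξ)^{1/α})` on the half-line `ξ > 0`, extended by `0`. For `1/2 < α < 1`,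
`2/α` times the real part of its Fourier transform is the density `h_α`. -/
def wrightSymbol (α : ℝ) : ℝ → ℂ :=
  (Ioi 0).indicator fun ξ => Complex.exp ((((2 * π * ξ : ℝ) : ℂ) * I) ^ ((1 / α : ℝ) : ℂ))

lemma ofReal_mul_I_cpow {ρ : ℝ} (hρ : 0 < ρ) (s : ℝ) :
    ((ρ : ℂ) * I) ^ (s : ℂ) = ((ρ ^ s : ℝ) : ℂ) * Complex.exp (((π / 2 * s : ℝ) : ℂ) * I) := by
  rw [Complex.cpow_def_of_ne_zero (by simp [hρ.ne']), Complex.log_ofReal_mul hρ Complex.I_ne_zero,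
    Complex.log_I, add_mul, Complex.exp_add, Complex.ofReal_cpow hρ.le,
    Complex.cpow_def_of_ne_zero (by simp [hρ.ne']), Complex.ofReal_log hρ.le]
  congr 2
  push_cast
  ring

lemma norm_cexp_ofReal_mul_I_cpow {ρ : ℝ} (hρ : 0 < ρ) (s : ℝ) :
    ‖Complex.exp (((ρ : ℂ) * I) ^ (s : ℂ))‖ = Real.exp (Real.cos (π / 2 * s) * ρ ^ s) := by
  rw [Complex.norm_exp, ofReal_mul_I_cpow hρ, Complex.re_ofReal_mul, Complex.exp_ofReal_mul_I_re,
    mul_comm]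

lemma cos_pi_div_two_mul_neg {s : ℝ} (hs : s ∈ Ioo (1 : ℝ) 2) : Real.cos (π / 2 * s) < 0 :=
  Real.cos_neg_of_pi_div_two_lt_of_lt (by nlinarith [hs.1, Real.pi_pos])
    (by nlinarith [hs.2, Real.pi_pos])

lemma one_div_mem_Ioo_one_two {α : ℝ} (hα : α ∈ Ioo (1 / 2 : ℝ) 1) : 1 / α ∈ Ioo (1 : ℝ) 2 := by
  have hα0 : 0 < α := by linarith [hα.1]
  exact ⟨by rw [lt_div_iff₀ hα0]; linarith [hα.2], by rw [div_lt_iff₀ hα0]; linarith [hα.1]⟩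

lemma norm_cexp_ofReal_mul_I_cpow_le_one {s ρ : ℝ} (hs : s ∈ Ioo (1 : ℝ) 2) (hρ : 0 < ρ) :
    ‖Complex.exp (((ρ : ℂ) * I) ^ (s : ℂ))‖ ≤ 1 := by
  rw [norm_cexp_ofReal_mul_I_cpow hρ, Real.exp_le_one_iff]
  exact mul_nonpos_of_nonpos_of_nonneg (cos_pi_div_two_mul_neg hs).le (by positivity)

lemma norm_wrightSymbol_le_one {α : ℝ} (hα : α ∈ Ioo (1 / 2 : ℝ) 1) (ξ : ℝ) :
    ‖wrightSymbol α ξ‖ ≤ 1 := by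
  unfold wrightSymbol
  by_cases hξ : ξ ∈ Ioi (0 : ℝ)
  · rw [indicator_of_mem hξ]
    exact norm_cexp_ofReal_mul_I_cpow_le_one (one_div_mem_Ioo_one_two hα)
      (mul_pos Real.two_pi_pos hξ)
  · simp [indicator_of_notMem hξ]

lemma measurable_cexp_ofReal_mul_I_cpow (s : ℝ) :
    Measurable fun ρ : ℝ => Complex.exp (((ρ : ℂ) * I) ^ (s : ℂ)) := by
  fun_prop

lemma measurable_wrightSymbol (α : ℝ) : Measurable (wrightSymbol α) :=
  ((measurable_cexp_ofReal_mul_I_cpow (1 / α)).comp (measurable_const_mul (2 * π))).indicator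
    measurableSet_Ioi

lemma integrableOn_exp_mul_exp_neg_rpow {s b : ℝ} (hs : 1 < s) (hb : 0 < b) (M : ℝ) :
    IntegrableOn (fun ρ : ℝ => Real.exp (M * ρ) * Real.exp (-b * ρ ^ s)) (Ioi 0) := by
  refine integrable_of_isBigO_exp_neg (b := 1) one_pos ?_ ?_
  · have : Continuous fun ρ : ℝ => ρ ^ s := Real.continuous_rpow_const (by positivity)
    fun_prop
  · simp_rw [← Real.exp_add]
    refine Asymptotics.IsBigO.of_bound 1 ?_
    have h : Tendsto (fun ρ : ℝ => ρ ^ (s - 1)) atTop atTop := tendsto_rpow_atTop (by linarith)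
    filter_upwards [h.eventually_ge_atTop ((M + 1) / b), eventually_gt_atTop 0] with ρ hρ hρ0
    rw [one_mul, Real.norm_of_nonneg (Real.exp_nonneg _), Real.norm_of_nonneg (Real.exp_nonneg _),
      Real.exp_le_exp]
    have hpow : ρ ^ s = ρ ^ (s - 1) * ρ := by
      rw [← Real.rpow_add_one hρ0.ne', sub_add_cancel]
    rw [div_le_iff₀ hb] at hρ
    rw [hpow]
    nlinarith

lemma integrableOn_exp_mul_norm_cexp {s : ℝ} (hs : s ∈ Ioo (1 : ℝ) 2) (M : ℝ) :
    IntegrableOn (fun ρ : ℝ => Real.exp (M * ρ) * ‖Complex.exp (((ρ : ℂ) * I) ^ (s : ℂ))‖)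
      (Ioi 0) := by
  refine (integrableOn_exp_mul_exp_neg_rpow hs.1
    (neg_pos.2 (cos_pi_div_two_mul_neg hs)) M).congr_fun (fun ρ hρ => ?_) measurableSet_Ioi
  simp only [norm_cexp_ofReal_mul_I_cpow hρ, neg_neg]

lemma integrable_wrightSymbol {α : ℝ} (hα : α ∈ Ioo (1 / 2 : ℝ) 1) :
    Integrable (wrightSymbol α) := by
  have h : IntegrableOn (fun ρ : ℝ => Complex.exp (((ρ : ℂ) * I) ^ ((1 / α : ℝ) : ℂ))) (Ioi 0) := by
    refine Integrable.mono' (integrableOn_exp_mul_norm_cexp (one_div_mem_Ioo_one_two hα) 0)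
      (measurable_cexp_ofReal_mul_I_cpow _).aestronglyMeasurable (Eventually.of_forall fun ρ => ?_)
    simp
  refine (integrable_indicator_iff measurableSet_Ioi).2 ?_
  have := (integrableOn_Ioi_comp_mul_left_iff
    (fun ρ : ℝ => Complex.exp (((ρ : ℂ) * I) ^ ((1 / α : ℝ) : ℂ))) 0 Real.two_pi_pos).2
    (by rwa [mul_zero])
  exact this

end WrightSymbol

section FourierRepresentation

lemma one_div_neg_cexp_mul_I_cpow {φ : ℝ} (hφ : φ ∈ Ioo 0 π) (s : ℝ) :
    (1 / -Complex.exp ((φ : ℂ) * I)) ^ (s : ℂ) =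
      Complex.exp (((s * (π - φ) : ℝ) : ℂ) * I) := by
  have h : 1 / -Complex.exp ((φ : ℂ) * I) = Complex.exp (((π - φ : ℝ) : ℂ) * I) := by
    rw [Complex.ofReal_sub, sub_mul, Complex.exp_sub, Complex.exp_pi_mul_I, one_div, inv_neg,
      neg_div, one_div]
  rw [h, Complex.cpow_def_of_ne_zero (Complex.exp_ne_zero _), Complex.log_exp]
  · push_cast
    ring_nf
  · rw [Complex.im_ofReal_mul, Complex.I_im]
    linarith [hφ.2, Real.pi_pos]
  · rw [Complex.im_ofReal_mul, Complex.I_im]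
    linarith [hφ.1]

lemma I_pow_mul_cexp (k : ℕ) {α : ℝ} (hα : α ≠ 0) :
    I ^ k * Complex.exp (((α * (k + 1) * (π - π / 2 * (1 / α)) : ℝ) : ℂ) * I) =
      -I * Complex.exp (((π * (α * (k + 1)) : ℝ) : ℂ) * I) := by
  have hphase : ((α * (k + 1) * (π - π / 2 * (1 / α)) : ℝ) : ℂ) * I =
      ((π * (α * (k + 1)) : ℝ) : ℂ) * I - (k + 1 : ℕ) * (π / 2 * I) := by
    have : (α : ℂ) ≠ 0 := by exact_mod_cast hα
    push_cast
    field_simp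
  rw [hphase, Complex.exp_sub, Complex.exp_nat_mul, Complex.exp_pi_div_two_mul_I, pow_succ,
    ← Complex.inv_I]
  field_simp

/-- Euler's integral along the ray `arg z = π/(2α)`, by the substitution `ρ = r^α`. -/
lemma integral_pow_mul_cexp_cpow {α : ℝ} (hα : α ∈ Ioo (1 / 2 : ℝ) 1) (k : ℕ) :
    ∫ ρ in Ioi (0 : ℝ), ((ρ : ℂ) * I) ^ k * Complex.exp (((ρ : ℂ) * I) ^ ((1 / α : ℝ) : ℂ)) =
      ((α * Real.Gamma (α * (k + 1)) : ℝ) : ℂ) *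
        (-I * Complex.exp (((π * (α * (k + 1)) : ℝ) : ℂ) * I)) := by
  have hα0 : 0 < α := by linarith [hα.1]
  have hs := one_div_mem_Ioo_one_two hα
  set φ := π / 2 * (1 / α) with hφ
  have hφ_mem : φ ∈ Ioo 0 π := ⟨by positivity, by nlinarith [hs.2, Real.pi_pos]⟩
  have hsubst : ∀ r ∈ Ioi (0 : ℝ), (α * r ^ (α - 1)) •
      ((((r ^ α : ℝ) : ℂ) * I) ^ k *
        Complex.exp ((((r ^ α : ℝ) : ℂ) * I) ^ ((1 / α : ℝ) : ℂ))) =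
      (α * I ^ k) * (((r ^ (α * (k + 1) - 1) : ℝ) : ℂ) *
        Complex.exp (-(-Complex.exp ((φ : ℂ) * I) * r))) := by
    intro r hr
    have hr0 : (0 : ℝ) < r := hr
    have hpow : r ^ (α * (k + 1) - 1) = r ^ (α - 1) * (r ^ α) ^ k := by
      rw [← Real.rpow_mul_natCast hr0.le, ← Real.rpow_add hr0]
      ring_nf
    rw [ofReal_mul_I_cpow (by positivity), ← Real.rpow_mul hr0.le, mul_one_div_cancel hα0.ne',
      Real.rpow_one, ← hφ, hpow, Complex.real_smul]
    push_cast
    ring_nf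
  rw [← integral_comp_rpow_Ioi_of_pos hα0, setIntegral_congr_fun measurableSet_Ioi hsubst,
    integral_const_mul, integral_rpow_mul_cexp_neg_mul_Ioi (by positivity),
    one_div_neg_cexp_mul_I_cpow hφ_mem]
  · rw [← I_pow_mul_cexp k hα0.ne', ← hφ]
    push_cast
    ring
  · rw [Complex.neg_re, Complex.exp_ofReal_mul_I_re, neg_pos]
    exact cos_pi_div_two_mul_neg hs

lemma wrightDensity_term {α : ℝ} (hα : 0 < α) (θ : ℝ) (k : ℕ) :
    (-θ) ^ k / ((k.factorial : ℝ) * Real.Gamma (1 - α - α * k)) =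
      (-θ) ^ k / k.factorial *
        (Real.Gamma (α * (k + 1)) * Real.sin (π * (α * (k + 1))) / π) := by
  have hG : 0 < Real.Gamma (α * (k + 1)) := Real.Gamma_pos_of_pos (by positivity)
  have hreflection : Real.Gamma (1 - α - α * k) =
      π / Real.sin (π * (α * (k + 1))) / Real.Gamma (α * (k + 1)) := by
    rw [← Real.Gamma_mul_Gamma_one_sub, mul_div_cancel_left₀ _ hG.ne']
    congr 1
    ring
  rw [hreflection, div_mul_eq_div_div]
  simp only [div_eq_mul_inv, mul_inv, inv_inv]
  ring

lemma hasSum_cexp (z : ℂ) : HasSum (fun k : ℕ => z ^ k / k.factorial) (Complex.exp z) := by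
  rw [Complex.exp_eq_exp_ℂ]
  exact NormedSpace.expSeries_div_hasSum_exp z

lemma hasSum_rexp (x : ℝ) : HasSum (fun k : ℕ => x ^ k / k.factorial) (Real.exp x) := by
  rw [Real.exp_eq_exp_ℝ]
  exact NormedSpace.expSeries_div_hasSum_exp x

lemma hasSum_integral_cexp_mul {f : ℝ → ℂ} (hf : Measurable f) (θ : ℝ)
    (hint : IntegrableOn (fun ρ => Real.exp (|θ| * ρ) * ‖f ρ‖) (Ioi 0)) :
    HasSum (fun k : ℕ => ∫ ρ in Ioi (0 : ℝ), (-(θ * ρ * I)) ^ k / k.factorial * f ρ)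
      (∫ ρ in Ioi (0 : ℝ), Complex.exp (-(θ * ρ * I)) * f ρ) := by
  have hbound (ρ : ℝ) :
      HasSum (fun k : ℕ => |θ * ρ| ^ k / k.factorial * ‖f ρ‖) (Real.exp |θ * ρ| * ‖f ρ‖) :=
    (hasSum_rexp _).mul_right _
  refine hasSum_integral_of_dominated_convergence
    (fun (k : ℕ) (ρ : ℝ) => |θ * ρ| ^ k / k.factorial * ‖f ρ‖) (fun k => ?_)
    (fun k => Eventually.of_forall fun ρ => ?_)
    (Eventually.of_forall fun ρ => (hbound ρ).summable) ?_
    (Eventually.of_forall fun ρ => (hasSum_cexp _).mul_right _)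
  · fun_prop
  · simp
  · refine hint.congr_fun (fun ρ hρ => ?_) measurableSet_Ioi
    beta_reduce
    rw [(hbound ρ).tsum_eq, abs_mul, abs_of_pos (mem_Ioi.1 hρ)]

lemma wrightDensity_eq_re_integral {α : ℝ} (hα : α ∈ Ioo (1 / 2 : ℝ) 1) (θ : ℝ) :
    wrightDensity α θ = (π * α)⁻¹ * (∫ ρ in Ioi (0 : ℝ), Complex.exp (-(θ * ρ * I)) *
      Complex.exp (((ρ : ℂ) * I) ^ ((1 / α : ℝ) : ℂ))).re := by
  have hα0 : 0 < α := by linarith [hα.1]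
  have hterm (k : ℕ) : ∫ ρ in Ioi (0 : ℝ), (-(θ * ρ * I)) ^ k / k.factorial *
        Complex.exp (((ρ : ℂ) * I) ^ ((1 / α : ℝ) : ℂ)) =
      (((-θ) ^ k / k.factorial * (α * Real.Gamma (α * (k + 1))) : ℝ) : ℂ) *
        (-I * Complex.exp (((π * (α * (k + 1)) : ℝ) : ℂ) * I)) := by
    calc _ = ∫ ρ in Ioi (0 : ℝ), ((-θ : ℂ) ^ k / k.factorial) * (((ρ : ℂ) * I) ^ k *
        Complex.exp (((ρ : ℂ) * I) ^ ((1 / α : ℝ) : ℂ))) := by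
          refine integral_congr_ae (Eventually.of_forall fun ρ => ?_)
          simp only [show -(θ * ρ * I) = (-θ : ℂ) * (ρ * I) by ring, mul_pow]
          ring
      _ = _ := by
          rw [integral_const_mul, integral_pow_mul_cexp_cpow hα]
          push_cast
          ring
  have hre := (Complex.hasSum_re (hasSum_integral_cexp_mul (measurable_cexp_ofReal_mul_I_cpow _) θ
    (integrableOn_exp_mul_norm_cexp (one_div_mem_Ioo_one_two hα) |θ|))).mul_left (π * α)⁻¹
  rw [← hre.tsum_eq, wrightDensity]
  refine tsum_congr fun k => ?_
  rw [wrightDensity_term hα0, hterm, Complex.re_ofReal_mul, neg_mul, Complex.neg_re,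
    Complex.I_mul_re, Complex.exp_ofReal_mul_I_im, neg_neg]
  field_simp

lemma wrightDensity_eq_fourier {α : ℝ} (hα : α ∈ Ioo (1 / 2 : ℝ) 1) (θ : ℝ) :
    wrightDensity α θ = 2 / α * (𝓕 (wrightSymbol α) θ).re := by
  have hsubst : 𝓕 (wrightSymbol α) θ = ((2 * π)⁻¹ : ℝ) • ∫ ρ in Ioi (0 : ℝ),
      Complex.exp (-(θ * ρ * I)) * Complex.exp (((ρ : ℂ) * I) ^ ((1 / α : ℝ) : ℂ)) := by
    rw [Real.fourier_real_eq_integral_exp_smul, ← mul_zero (2 * π),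
      ← integral_comp_mul_left_Ioi _ _ Real.two_pi_pos, ← integral_indicator measurableSet_Ioi]
    refine integral_congr_ae (Eventually.of_forall fun ξ => ?_)
    simp only [wrightSymbol, indicator, smul_eq_mul]
    split_ifs
    · congr 2
      push_cast
      ring
    · rw [mul_zero]
  rw [wrightDensity_eq_re_integral hα, hsubst, Complex.smul_re, smul_eq_mul, ← mul_assoc]
  congr 1
  field_simp

lemma integral_fourier_mul_eq {f g : ℝ → ℂ} (hf : Integrable f) (hg : Integrable g) :
    ∫ ξ, 𝓕 f ξ * g ξ = ∫ x, f x * 𝓕 g x := by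
  simpa using! VectorFourier.integral_fourierIntegral_smul_eq_flip (L := innerₗ ℝ)
    Real.continuous_fourierChar continuous_inner hf hg

lemma integrable_mul_fourier {f g : ℝ → ℂ} (hf : Integrable f) (hg : Integrable g) :
    Integrable fun x => f x * 𝓕 g x := by
  have hcont : Continuous (𝓕 g) := VectorFourier.fourierIntegral_continuous
    Real.continuous_fourierChar continuous_inner hg
  exact hf.mul_bdd (c := ∫ x, ‖g x‖) hcont.aestronglyMeasurable
    (Eventually.of_forall fun ξ => VectorFourier.norm_fourierIntegral_le_integral_norm _ _ _ _ _)

end FourierRepresentation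

section Concentration

lemma integrable_mul_wrightDensity {α : ℝ} (hα : α ∈ Ioo (1 / 2 : ℝ) 1) {φ : ℝ → ℝ}
    (hφ : Integrable φ) : Integrable fun θ => φ θ * wrightDensity α θ := by
  refine ((integrable_mul_fourier hφ.ofReal (integrable_wrightSymbol hα)).re.const_mul
    (2 / α)).congr (Eventually.of_forall fun θ => ?_)
  simp only [RCLike.re_to_complex, Complex.coe_algebraMap, Complex.re_ofReal_mul,
    wrightDensity_eq_fourier hα]
  ring

lemma integral_mul_wrightDensity {α : ℝ} (hα : α ∈ Ioo (1 / 2 : ℝ) 1) {φ : ℝ → ℝ}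
    (hφ : Integrable φ) : ∫ θ, φ θ * wrightDensity α θ =
      2 / α * (∫ ξ, 𝓕 (fun θ => (φ θ : ℂ)) ξ * wrightSymbol α ξ).re := by
  have hg := integrable_wrightSymbol hα
  have hφ' : Integrable fun θ => (φ θ : ℂ) := hφ.ofReal
  have hre : ∫ θ, ((φ θ : ℂ) * 𝓕 (wrightSymbol α) θ).re =
      (∫ θ, (φ θ : ℂ) * 𝓕 (wrightSymbol α) θ).re :=
    integral_re (𝕜 := ℂ) (integrable_mul_fourier hφ' hg)
  rw [integral_fourier_mul_eq hφ' hg, ← hre, ← integral_const_mul]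
  refine integral_congr_ae (Eventually.of_forall fun θ => ?_)
  simp only [Complex.re_ofReal_mul, wrightDensity_eq_fourier hα]
  ring

lemma fourier_ofReal_neg (φ : ℝ → ℝ) (ξ : ℝ) :
    𝓕 (fun θ => (φ θ : ℂ)) (-ξ) = starRingEnd ℂ (𝓕 (fun θ => (φ θ : ℂ)) ξ) := by
  rw [Real.fourier_real_eq_integral_exp_smul, Real.fourier_real_eq_integral_exp_smul,
    ← integral_conj]
  refine integral_congr_ae (Eventually.of_forall fun θ => ?_)
  simp only [smul_eq_mul, map_mul, ← Complex.exp_conj, Complex.conj_ofReal, Complex.conj_I]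
  congr 2
  push_cast
  ring

lemma two_mul_re_integral_Ioi {g : ℝ → ℂ} (hg : Integrable g)
    (hsymm : ∀ x, g (-x) = starRingEnd ℂ (g x)) :
    2 * (∫ x in Ioi (0 : ℝ), g x).re = (∫ x, g x).re := by
  have h : ∫ x in Iic (0 : ℝ), g x = starRingEnd ℂ (∫ x in Ioi (0 : ℝ), g x) := by
    rw [← integral_conj, ← neg_zero, ← integral_comp_neg_Ioi]
    simp only [hsymm, neg_zero]
  rw [← intervalIntegral.integral_Iic_add_Ioi hg.integrableOn hg.integrableOn (b := 0), h,
    Complex.add_re, Complex.conj_re, two_mul]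

lemma fourier_half_inversion {φ : ℝ → ℝ} (hc : Continuous φ) (hφ : Integrable φ)
    (hF : Integrable (𝓕 fun θ => (φ θ : ℂ))) (x : ℝ) :
    2 * (∫ ξ in Ioi (0 : ℝ), 𝓕 (fun θ => (φ θ : ℂ)) ξ *
      Complex.exp (((2 * π * ξ * x : ℝ) : ℂ) * I)).re = φ x := by
  have hint : Integrable fun ξ : ℝ => 𝓕 (fun θ => (φ θ : ℂ)) ξ *
      Complex.exp (((2 * π * ξ * x : ℝ) : ℂ) * I) := by
    refine hF.mul_bdd (c := 1) (Continuous.aestronglyMeasurable (by fun_prop))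
      (Eventually.of_forall fun ξ => ?_)
    rw [Complex.norm_exp_ofReal_mul_I]
  have hinv : 𝓕⁻ (𝓕 fun θ => (φ θ : ℂ)) x = φ x := by
    rw [Continuous.fourierInv_fourier_eq (by fun_prop) hφ.ofReal hF]
  rw [two_mul_re_integral_Ioi hint fun ξ => ?_, ← Complex.ofReal_re (φ x), ← hinv,
    Real.fourierInv_eq_fourier_neg, Real.fourier_real_eq_integral_exp_smul]
  · refine congrArg Complex.re (integral_congr_ae (Eventually.of_forall fun ξ => ?_))
    beta_reduce
    rw [smul_eq_mul, mul_comm]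
    congr 3
    push_cast
    ring
  · rw [map_mul, fourier_ofReal_neg, ← Complex.exp_conj, map_mul, Complex.conj_ofReal,
      Complex.conj_I]
    congr 2
    push_cast
    ring

lemma tendsto_wrightSymbol (ξ : ℝ) :
    Tendsto (fun α => wrightSymbol α ξ) (𝓝[<] 1)
      (𝓝 ((Ioi 0).indicator (fun ξ : ℝ => Complex.exp (((2 * π * ξ : ℝ) : ℂ) * I)) ξ)) := by
  by_cases hξ : ξ ∈ Ioi (0 : ℝ)
  · have hne : ((2 * π * ξ : ℝ) : ℂ) * I ≠ 0 := mul_ne_zero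
      (Complex.ofReal_ne_zero.2 (mul_pos Real.two_pi_pos hξ).ne') Complex.I_ne_zero
    have hexp : ContinuousAt (fun α : ℝ => ((1 / α : ℝ) : ℂ)) 1 :=
      Complex.continuous_ofReal.continuousAt.comp
        (continuousAt_const.div continuousAt_id one_ne_zero)
    have h := (hexp.const_cpow (Or.inl hne)).cexp.tendsto.mono_left
      (nhdsWithin_le_nhds (s := Iio 1))
    simpa only [wrightSymbol, indicator_of_mem hξ, div_one, Complex.ofReal_one,
      Complex.cpow_one] using h
  · simp only [wrightSymbol, indicator_of_notMem hξ, tendsto_const_nhds]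

lemma eventually_mem_Ioo_nhdsLT : ∀ᶠ α : ℝ in 𝓝[<] 1, α ∈ Ioo (1 / 2 : ℝ) 1 :=
  Ioo_mem_nhdsLT (by norm_num)

lemma tendsto_integral_mul_wrightDensity {φ : ℝ → ℝ} (hc : Continuous φ) (hφ : Integrable φ)
    (hF : Integrable (𝓕 fun θ => (φ θ : ℂ))) :
    Tendsto (fun α => ∫ θ, φ θ * wrightDensity α θ) (𝓝[<] 1) (𝓝 (φ 1)) := by
  have hdct := tendsto_integral_filter_of_dominated_convergence
    (F := fun α ξ => 𝓕 (fun θ => (φ θ : ℂ)) ξ * wrightSymbol α ξ)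
    (fun ξ => ‖𝓕 (fun θ => (φ θ : ℂ)) ξ‖)
    (Eventually.of_forall fun α =>
      hF.aestronglyMeasurable.mul (measurable_wrightSymbol α).aestronglyMeasurable)
    (eventually_mem_Ioo_nhdsLT.mono fun α hα => Eventually.of_forall fun ξ => by
      rw [norm_mul]
      exact mul_le_of_le_one_right (norm_nonneg _) (norm_wrightSymbol_le_one hα ξ))
    hF.norm
    (Eventually.of_forall fun ξ => (tendsto_wrightSymbol ξ).const_mul _)
  have hcoeff : Tendsto (fun α : ℝ => 2 / α) (𝓝[<] 1) (𝓝 2) := by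
    have h : ContinuousAt (fun α : ℝ => 2 / α) 1 :=
      continuousAt_const.div continuousAt_id one_ne_zero
    simpa only [div_one] using h.tendsto.mono_left (nhdsWithin_le_nhds (s := Iio 1))
  have hlim := hcoeff.mul ((Complex.continuous_re.tendsto _).comp hdct)
  have hval := fourier_half_inversion hc hφ hF 1
  simp only [mul_one] at hval
  simp only [← indicator_mul_right, integral_indicator measurableSet_Ioi, hval] at hlim
  exact hlim.congr' (eventually_mem_Ioo_nhdsLT.mono fun α hα =>
    (integral_mul_wrightDensity hα hφ).symm)

end Concentration

section WrightMass

/-- Quantitative positivity of the density `h_α`, whose sign is not otherwise known: its positive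
part has mass at least `c` on the interval `[a, b] ⊆ (0, ∞)`. -/
structure WrightMass (α a b c : ℝ) : Prop where
  a_pos : 0 < a
  b_pos : 0 < b
  c_pos : 0 < c
  le_mass : ENNReal.ofReal c ≤ ∫⁻ θ in Icc a b, ENNReal.ofReal (wrightDensity α θ)

lemma ofReal_integral_mul_wrightDensity_le {α a b : ℝ} (hα : α ∈ Ioo (1 / 2 : ℝ) 1) {φ : ℝ → ℝ}
    (hφ : Integrable φ) (h0 : ∀ θ, 0 ≤ φ θ) (h1 : ∀ θ, φ θ ≤ 1) (hsupp : ∀ θ ∉ Icc a b, φ θ = 0) :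
    ENNReal.ofReal (∫ θ, φ θ * wrightDensity α θ) ≤
      ∫⁻ θ in Icc a b, ENNReal.ofReal (wrightDensity α θ) := by
  have hint := integrable_mul_wrightDensity hα hφ
  calc ENNReal.ofReal (∫ θ, φ θ * wrightDensity α θ)
      ≤ ENNReal.ofReal (∫ θ, max (φ θ * wrightDensity α θ) 0) :=
        ENNReal.ofReal_le_ofReal (integral_mono hint hint.pos_part fun θ => le_max_left _ _)
    _ = ∫⁻ θ, ENNReal.ofReal (max (φ θ * wrightDensity α θ) 0) :=
        ofReal_integral_eq_lintegral_ofReal hint.pos_part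
          (Eventually.of_forall fun θ => le_max_right _ _)
    _ ≤ ∫⁻ θ, (Icc a b).indicator (fun θ => ENNReal.ofReal (wrightDensity α θ)) θ := by
        refine lintegral_mono fun θ => ?_
        by_cases hθ : θ ∈ Icc a b
        · rw [indicator_of_mem hθ, ENNReal.ofReal_max, ENNReal.ofReal_zero, max_eq_left zero_le,
            ENNReal.ofReal_mul (h0 θ)]
          exact mul_le_of_le_one_left zero_le (ENNReal.ofReal_le_one.2 (h1 θ))
        · simp [hsupp θ hθ]
    _ = _ := lintegral_indicator measurableSet_Icc _

lemma eventually_wrightMass : ∀ᶠ α : ℝ in 𝓝[<] 1, WrightMass α (1 / 2) (3 / 2) (1 / 2) := by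
  let φ : ContDiffBump (1 : ℝ) := ⟨1 / 4, 1 / 2, by norm_num, by norm_num⟩
  have hφ1 : φ 1 = 1 := φ.one_of_mem_closedBall (Metric.mem_closedBall_self φ.rIn_pos.le)
  have hsupp : ∀ θ ∉ Icc (1 / 2 : ℝ) (3 / 2), φ θ = 0 := fun θ hθ => by
    refine φ.zero_of_le_dist (le_of_not_gt fun hlt => hθ ?_)
    change |θ - 1| < 1 / 2 at hlt
    rw [abs_lt] at hlt
    constructor <;> linarith [hlt.1, hlt.2]
  have hcs : HasCompactSupport fun θ => (φ θ : ℂ) :=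
    φ.hasCompactSupport.comp_left (g := fun x : ℝ => (x : ℂ)) Complex.ofReal_zero
  have hsm : ContDiff ℝ (⊤ : ℕ∞) fun θ => (φ θ : ℂ) :=
    Complex.ofRealCLM.contDiff.comp φ.contDiff
  have hF : Integrable (𝓕 fun θ => (φ θ : ℂ)) := (𝓕 (hcs.toSchwartzMap hsm)).integrable
  have hlim := tendsto_integral_mul_wrightDensity φ.continuous φ.integrable hF
  rw [hφ1] at hlim
  filter_upwards [eventually_mem_Ioo_nhdsLT, hlim.eventually_const_lt one_half_lt_one]
    with α hα hlt
  exact ⟨by norm_num, by norm_num, by norm_num, (ENNReal.ofReal_le_ofReal hlt.le).trans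
    (ofReal_integral_mul_wrightDensity_le hα φ.integrable (fun _ => φ.nonneg) (fun _ => φ.le_one)
      hsupp)⟩

lemma norm_wrightDensity_term_le {α : ℝ} (hα : α ∈ Ioo (0 : ℝ) 1) (θ : ℝ) (k : ℕ) :
    ‖(-θ) ^ k / ((k.factorial : ℝ) * Real.Gamma (1 - α - α * k))‖ ≤
      (Real.Gamma α + 1) * |θ| ^ k := by
  obtain ⟨hα0, hα1⟩ := hα
  have hGα : 0 < Real.Gamma α := Real.Gamma_pos_of_pos hα0
  have hk : (1 : ℝ) ≤ k.factorial := mod_cast k.factorial_pos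
  have hpos : 0 < Real.Gamma (α * (k + 1)) := Real.Gamma_pos_of_pos (by positivity)
  have hGamma : Real.Gamma (α * (k + 1)) ≤ (Real.Gamma α + 1) * k.factorial := by
    have hmem : α * (k + 1) ∈ Icc α ((k : ℝ) + 1) :=
      ⟨le_mul_of_one_le_right hα0.le (by simp), mul_le_of_le_one_left (by positivity) hα1.le⟩
    have h := Real.convexOn_Gamma.le_max_of_mem_Icc hα0 (mem_Ioi.2 (by positivity)) hmem
    rw [Real.Gamma_nat_eq_factorial] at h
    exact h.trans (max_le (by nlinarith) (by nlinarith))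
  have hsin : |Real.sin (π * (α * (k + 1)))| / π ≤ 1 :=
    (div_le_one Real.pi_pos).2 ((Real.abs_sin_le_one _).trans (by linarith [Real.pi_gt_three]))
  rw [wrightDensity_term hα0, Real.norm_eq_abs, abs_mul, abs_div, abs_pow, abs_neg, abs_div,
    abs_mul, abs_of_pos hpos, abs_of_pos Real.pi_pos, Nat.abs_cast]
  calc |θ| ^ k / k.factorial * (Real.Gamma (α * (k + 1)) * |Real.sin (π * (α * (k + 1)))| / π)
      ≤ |θ| ^ k / k.factorial * ((Real.Gamma α + 1) * k.factorial * 1) := by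
        rw [mul_div_assoc (Real.Gamma _)]
        gcongr
    _ = (Real.Gamma α + 1) * |θ| ^ k := by field_simp

lemma continuousOn_wrightDensity {α : ℝ} (hα : α ∈ Ioo (0 : ℝ) 1) :
    ContinuousOn (wrightDensity α) (Icc (-(1 / 2)) (1 / 2)) := by
  refine continuousOn_tsum (u := fun k : ℕ => (Real.Gamma α + 1) * (1 / 2) ^ k)
    (fun k => by fun_prop) (summable_geometric_two.mul_left _) fun k θ hθ => ?_
  have hΓ : 0 < Real.Gamma α := Real.Gamma_pos_of_pos hα.1
  refine (norm_wrightDensity_term_le hα θ k).trans ?_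
  gcongr
  exact abs_le.2 hθ

lemma wrightDensity_zero_pos {α : ℝ} (hα : α < 1) : 0 < wrightDensity α 0 := by
  have h : wrightDensity α 0 = (Real.Gamma (1 - α))⁻¹ := by
    rw [wrightDensity, tsum_eq_single 0 fun k hk => by simp [hk]]
    simp
  rw [h]
  exact inv_pos.2 (Real.Gamma_pos_of_pos (sub_pos.2 hα))

lemma wrightMass_of_le {α a b m : ℝ} (ha : 0 < a) (hab : a < b) (hm : 0 < m)
    (h : ∀ θ ∈ Icc a b, m ≤ wrightDensity α θ) : WrightMass α a b (m * (b - a)) := by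
  refine ⟨ha, ha.trans hab, mul_pos hm (sub_pos.2 hab), ?_⟩
  rw [ENNReal.ofReal_mul hm.le, ← Real.volume_Icc, ← setLIntegral_const]
  exact setLIntegral_mono' measurableSet_Icc fun θ hθ => ENNReal.ofReal_le_ofReal (h θ hθ)

lemma exists_wrightMass {α : ℝ} (hα : α ∈ Ioo (0 : ℝ) 1) : ∃ a b c, WrightMass α a b c := by
  have h0 := wrightDensity_zero_pos hα.2
  have hcont : ContinuousAt (wrightDensity α) 0 :=
    (continuousOn_wrightDensity hα).continuousAt (Icc_mem_nhds (by norm_num) (by norm_num))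
  obtain ⟨ε, hε, hball⟩ := Metric.eventually_nhds_iff.1
    (hcont.eventually_const_lt (half_lt_self h0))
  refine ⟨ε / 4, ε / 2, _, wrightMass_of_le (by positivity) (by linarith) (half_pos h0)
    fun θ hθ => (hball ?_).le⟩
  rw [Real.dist_0_eq_abs, abs_lt]
  constructor <;> linarith [hθ.1, hθ.2]

end WrightMass

section Kernel

variable {N : ℕ} {α a b c R t : ℝ} {x : EuclideanSpace ℝ (Fin N)}

/-- A lower bound for the Gauss kernel `G(θ, x)` over `θ ∈ [a, b]` and `|x| ≤ 4`. -/
def gaussConst (N : ℕ) (a b : ℝ) : ℝ :=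
  (4 * π * b) ^ (-((N : ℝ) / 2)) * Real.exp (-(4 / a))

lemma gaussConst_pos (N : ℕ) (a : ℝ) (hb : 0 < b) : 0 < gaussConst N a b := by
  unfold gaussConst
  positivity

lemma gaussConst_div_le_heatKernel (ha : 0 < a) (hR : 0 < R) {θ : ℝ} (hθ : θ ∈ Icc a b)
    (hx : ‖x‖ ≤ 4 * R) : gaussConst N a b / R ^ N ≤ heatKernel N (R ^ 2 * θ) x := by
  have hθ0 : 0 < θ := ha.trans_le hθ.1
  have hb : 0 < b := hθ0.trans_le hθ.2
  have hscale : (4 * π * b) ^ (-((N : ℝ) / 2)) / R ^ N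
      = (4 * π * b * R ^ 2) ^ (-((N : ℝ) / 2)) := by
    rw [Real.mul_rpow (y := R ^ 2) (by positivity) (by positivity), div_eq_mul_inv,
      ← Real.rpow_natCast R 2, ← Real.rpow_mul hR.le, ← Real.rpow_natCast R N,
      ← Real.rpow_neg hR.le]
    congr 2
    push_cast
    ring
  have hpow : (4 * π * b) ^ (-((N : ℝ) / 2)) / R ^ N
      ≤ (4 * π * (R ^ 2 * θ)) ^ (-((N : ℝ) / 2)) := by
    rw [hscale]
    refine Real.rpow_le_rpow_of_nonpos (by positivity) ?_ (neg_nonpos.2 (by positivity))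
    calc 4 * π * (R ^ 2 * θ) ≤ 4 * π * (R ^ 2 * b) := by gcongr; exact hθ.2
      _ = 4 * π * b * R ^ 2 := by ring
  have hexp : ‖x‖ ^ 2 / (4 * (R ^ 2 * θ)) ≤ 4 / a := by
    calc ‖x‖ ^ 2 / (4 * (R ^ 2 * θ)) ≤ (4 * R) ^ 2 / (4 * (R ^ 2 * a)) := by gcongr; exact hθ.1
      _ = 4 / a := by field_simp
  calc gaussConst N a b / R ^ N
      = (4 * π * b) ^ (-((N : ℝ) / 2)) / R ^ N * Real.exp (-(4 / a)) := by
        rw [gaussConst, mul_div_right_comm]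
    _ ≤ heatKernel N (R ^ 2 * θ) x := by unfold heatKernel; gcongr

lemma mul_closedBall_le_heatSemigroup (ha : 0 < a) (hR : 0 < R) {θ : ℝ} (hθ : θ ∈ Icc a b)
    (μ : Measure (EuclideanSpace ℝ (Fin N))) :
    ENNReal.ofReal (gaussConst N a b / R ^ N) * μ (Metric.closedBall x (4 * R))
      ≤ heatSemigroup (R ^ 2 * θ) μ x :=
  calc ENNReal.ofReal (gaussConst N a b / R ^ N) * μ (Metric.closedBall x (4 * R))
      = ∫⁻ _ in Metric.closedBall x (4 * R), ENNReal.ofReal (gaussConst N a b / R ^ N) ∂μ :=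
        (setLIntegral_const _ _).symm
    _ ≤ ∫⁻ y in Metric.closedBall x (4 * R), ENNReal.ofReal (heatKernel N (R ^ 2 * θ) (x - y)) ∂μ :=
        setLIntegral_mono' Metric.isClosed_closedBall.measurableSet fun y hy =>
          ENNReal.ofReal_le_ofReal <| gaussConst_div_le_heatKernel ha hR hθ <| by
            rwa [← dist_eq_norm, dist_comm]
    _ ≤ heatSemigroup (R ^ 2 * θ) μ x := setLIntegral_le_lintegral _ _

lemma mul_closedBall_le_lintegral_heatSemigroup (ha : 0 < a) (hR : 0 < R) {w : ℝ → ℝ≥0∞}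
    {m : ℝ} (hm : 0 ≤ m) (hw : ENNReal.ofReal m ≤ ∫⁻ θ in Icc a b, w θ)
    (μ : Measure (EuclideanSpace ℝ (Fin N))) :
    ENNReal.ofReal (gaussConst N a b * m / R ^ N) * μ (Metric.closedBall x (4 * R))
      ≤ ∫⁻ θ in Ioi (0 : ℝ), w θ * heatSemigroup (R ^ 2 * θ) μ x :=
  calc ENNReal.ofReal (gaussConst N a b * m / R ^ N) * μ (Metric.closedBall x (4 * R))
      = ENNReal.ofReal m *
          (ENNReal.ofReal (gaussConst N a b / R ^ N) * μ (Metric.closedBall x (4 * R))) := by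
        rw [← mul_assoc, ← ENNReal.ofReal_mul hm, mul_comm (gaussConst N a b), mul_div_assoc]
    _ ≤ (∫⁻ θ in Icc a b, w θ) *
          (ENNReal.ofReal (gaussConst N a b / R ^ N) * μ (Metric.closedBall x (4 * R))) := by
        gcongr
    _ ≤ ∫⁻ θ in Icc a b, w θ *
          (ENNReal.ofReal (gaussConst N a b / R ^ N) * μ (Metric.closedBall x (4 * R))) :=
        lintegral_mul_const_le _ _
    _ ≤ ∫⁻ θ in Icc a b, w θ * heatSemigroup (R ^ 2 * θ) μ x := by
        refine setLIntegral_mono' measurableSet_Icc fun θ hθ => ?_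
        gcongr
        exact mul_closedBall_le_heatSemigroup ha hR hθ μ
    _ ≤ ∫⁻ θ in Ioi (0 : ℝ), w θ * heatSemigroup (R ^ 2 * θ) μ x :=
        lintegral_mono_set fun _ hθ => ha.trans_le hθ.1

lemma WrightMass.mul_le_lintegral_mul (h : WrightMass α a b c) :
    ENNReal.ofReal (a * c) ≤ ∫⁻ θ in Icc a b, ENNReal.ofReal (θ * wrightDensity α θ) :=
  calc ENNReal.ofReal (a * c) = ENNReal.ofReal a * ENNReal.ofReal c :=
        ENNReal.ofReal_mul h.a_pos.le
    _ ≤ ENNReal.ofReal a * ∫⁻ θ in Icc a b, ENNReal.ofReal (wrightDensity α θ) := by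
        gcongr
        exact h.le_mass
    _ ≤ ∫⁻ θ in Icc a b, ENNReal.ofReal a * ENNReal.ofReal (wrightDensity α θ) :=
        lintegral_const_mul_le _ _
    _ ≤ ∫⁻ θ in Icc a b, ENNReal.ofReal (θ * wrightDensity α θ) := by
        refine setLIntegral_mono' measurableSet_Icc fun θ hθ => ?_
        rw [ENNReal.ofReal_mul (h.a_pos.le.trans hθ.1)]
        gcongr
        exact hθ.1

lemma rpow_half_sq (ht : 0 ≤ t) (α : ℝ) : (t ^ (α / 2)) ^ 2 = t ^ α := by
  rw [← Real.rpow_mul_natCast ht, Nat.cast_ofNat, div_mul_cancel₀ _ two_ne_zero]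

/-- The lower bound `g t^{-αN/2} μ(B(x, 4t^{α/2}))`, with the closed ball, for both `P_α(t)μ` and
`α S_α(t)μ`. Everything that the proof uses about `h_α` enters through the constant `g`, which can
be chosen uniformly for `α` near `1`. -/
structure ParabolicLowerBound (N : ℕ) (α g : ℝ) : Prop where
  pos : 0 < g
  le_opP : ∀ {t : ℝ}, 0 < t → ∀ (μ : Measure (EuclideanSpace ℝ (Fin N))) x,
    ENNReal.ofReal (g / (t ^ (α / 2)) ^ N) * μ (Metric.closedBall x (4 * t ^ (α / 2)))
      ≤ opP α t μ x
  le_opS : ∀ {t : ℝ}, 0 < t → ∀ (μ : Measure (EuclideanSpace ℝ (Fin N))) x,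
    ENNReal.ofReal (g / (t ^ (α / 2)) ^ N) * μ (Metric.closedBall x (4 * t ^ (α / 2)))
      ≤ ENNReal.ofReal α * opS α t μ x

lemma WrightMass.parabolicLowerBound (N : ℕ) {α₀ : ℝ} (h : WrightMass α a b c) (hα₀ : 0 < α₀)
    (hα : α₀ ≤ α) : ParabolicLowerBound N α (gaussConst N a b * c * min 1 (α₀ * a)) := by
  have ha := h.a_pos
  have hc := h.c_pos
  have hg := gaussConst_pos N a h.b_pos
  have hleP : gaussConst N a b * c * min 1 (α₀ * a) ≤ gaussConst N a b * c :=
    mul_le_of_le_one_right (by positivity) (min_le_left _ _)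
  have hleS : gaussConst N a b * c * min 1 (α₀ * a) ≤ α * (gaussConst N a b * (a * c)) :=
    calc gaussConst N a b * c * min 1 (α₀ * a) ≤ gaussConst N a b * c * (α * a) :=
          mul_le_mul_of_nonneg_left ((min_le_right _ _).trans (by gcongr)) (by positivity)
      _ = α * (gaussConst N a b * (a * c)) := by ring
  refine ⟨by positivity, fun {t} ht μ x => ?_, fun {t} ht μ x => ?_⟩
  · have hP := mul_closedBall_le_lintegral_heatSemigroup (x := x) ha
      (R := t ^ (α / 2)) (by positivity) hc.le h.le_mass μ
    rw [rpow_half_sq ht.le] at hP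
    refine le_trans ?_ hP
    gcongr
  · have hS := mul_closedBall_le_lintegral_heatSemigroup (x := x) ha
      (R := t ^ (α / 2)) (by positivity) (by positivity) h.mul_le_lintegral_mul μ
    rw [rpow_half_sq ht.le] at hS
    refine le_trans ?_ (mul_le_mul_right hS (ENNReal.ofReal α))
    rw [← mul_assoc, ← ENNReal.ofReal_mul (hα₀.le.trans hα), ← mul_div_assoc]
    gcongr

lemma exists_parabolicLowerBound (N : ℕ) (hα : α ∈ Ioo 0 1) :
    ∃ g, ParabolicLowerBound N α g := by
  obtain ⟨a, b, c, h⟩ := exists_wrightMass hα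
  exact ⟨_, h.parabolicLowerBound N hα.1 le_rfl⟩

lemma eventually_parabolicLowerBound (N : ℕ) :
    ∃ g, 0 < g ∧ ∀ᶠ α in 𝓝[<] 1, ParabolicLowerBound N α g := by
  have hg := gaussConst_pos N (1 / 2) (b := 3 / 2) (by norm_num)
  refine ⟨gaussConst N (1 / 2) (3 / 2) * (1 / 2) * min 1 (1 / 2 * (1 / 2)), by positivity, ?_⟩
  filter_upwards [eventually_wrightMass, eventually_mem_Ioo_nhdsLT] with α h hα
  exact h.parabolicLowerBound N one_half_pos hα.1.le

end Kernel

lemma exists_mul_sub_eq {Λ : ℝ → ℝ} {t θ b W : ℝ} (htθ : t ≤ θ) (hΛ : ContinuousOn Λ (Icc t θ))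
    (hW : 0 ≤ W) (hWb : W ≤ b * (Λ θ - Λ t)) : ∃ t' ∈ Icc t θ, b * (Λ t' - Λ t) = W :=
  intermediate_value_Icc htθ (f := fun s => b * (Λ s - Λ t)) (by fun_prop) ⟨by simpa, hWb⟩

/-- Doubling `A` costs at most `W / A ^ r` on the clock `Λ`, so all doublings together cost at most
the geometric sum `W / A ^ r / (1 - 2 ^ (-r))`, and boundedness forbids having that much time. -/
lemma rpow_mul_sub_le_of_doubling {P : ℝ → ℝ → Prop} {Λ : ℝ → ℝ} {τ θ r W A : ℝ} (hr : 0 < r)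
    (hτθ : τ ≤ θ) (hW : 0 ≤ W) (hA : 0 < A) (hΛ : ContinuousOn Λ (Icc τ θ))
    (hdouble : ∀ t ∈ Icc τ θ, ∀ t' ∈ Icc t θ, ∀ B > 0,
      P t B → W ≤ B ^ r * (Λ t' - Λ t) → P t' (2 * B))
    (hbdd : ∃ M, ∀ t ∈ Icc τ θ, ∀ B, P t B → B ≤ M) (hP : P τ A) :
    A ^ r * (Λ θ - Λ τ) ≤ W / (1 - 2 ^ (-r)) := by
  have hgap : 0 < 1 - (2 : ℝ) ^ (-r) :=
    sub_pos.2 (Real.rpow_lt_one_of_one_lt_of_neg one_lt_two (neg_neg_of_pos hr))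
  set S := W / (1 - (2 : ℝ) ^ (-r)) with hS
  have hSW : S - W = 2 ^ (-r) * S := by
    rw [hS]
    field_simp
    ring
  have hWS : W ≤ S := by
    have : 0 ≤ 2 ^ (-r) * S := by positivity
    linarith
  by_contra! hlt
  have hdoublings : ∀ k : ℕ, ∃ t ∈ Icc τ θ, P t (2 ^ k * A) ∧
      S < (2 ^ k * A) ^ r * (Λ θ - Λ t) := by
    intro k
    induction k with
    | zero => exact ⟨τ, left_mem_Icc.2 hτθ, by simpa using hP, by simpa using hlt⟩
    | succ k ih =>
      obtain ⟨t, ht, hPt, hSt⟩ := ih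
      set B := 2 ^ k * A with hB
      have hB0 : 0 < B := by positivity
      obtain ⟨t', ht', hcost⟩ := exists_mul_sub_eq ht.2 (hΛ.mono (Icc_subset_Icc_left ht.1)) hW
        (hWS.trans_lt hSt).le
      have hBk : 2 ^ (k + 1) * A = 2 * B := by rw [hB]; ring
      refine ⟨t', ⟨ht.1.trans ht'.1, ht'.2⟩, hBk ▸ hdouble t ht t' ht' B hB0 hPt hcost.ge, ?_⟩
      calc S = 2 ^ r * (S - W) := by
            rw [hSW, ← mul_assoc, ← Real.rpow_add two_pos, add_neg_cancel, Real.rpow_zero, one_mul]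
        _ < 2 ^ r * (B ^ r * (Λ θ - Λ t) - B ^ r * (Λ t' - Λ t)) := by
            rw [hcost]
            gcongr
        _ = (2 ^ (k + 1) * A) ^ r * (Λ θ - Λ t') := by
            rw [hBk, Real.mul_rpow two_pos.le hB0.le]
            ring
  obtain ⟨M, hM⟩ := hbdd
  obtain ⟨k, hk⟩ := pow_unbounded_of_one_lt (M / A) one_lt_two
  obtain ⟨t, ht, hPt, -⟩ := hdoublings k
  exact (hM t ht _ hPt).not_gt ((div_lt_iff₀ hA).1 hk)

section Density

variable {N : ℕ} {α g p A r ρ τ : ℝ} {w x z : EuclideanSpace ℝ (Fin N)}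
  {f : EuclideanSpace ℝ (Fin N) → ℝ≥0∞}

/-- The volume of the unit ball of `ℝ^N`. -/
def unitBallVolume (N : ℕ) : ℝ := volume.real (Metric.ball (0 : EuclideanSpace ℝ (Fin N)) 1)

lemma unitBallVolume_pos (N : ℕ) : 0 < unitBallVolume N :=
  ENNReal.toReal_pos (Metric.measure_ball_pos _ _ one_pos).ne' measure_ball_lt_top.ne

lemma volume_ball_eq (w : EuclideanSpace ℝ (Fin N)) (hr : 0 < r) :
    volume (Metric.ball w r) = ENNReal.ofReal (unitBallVolume N * r ^ N) := by
  rw [Measure.addHaar_ball_of_pos _ _ hr, finrank_euclideanSpace_fin, mul_comm, unitBallVolume,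
    ENNReal.ofReal_mul measureReal_nonneg, ofReal_measureReal measure_ball_lt_top.ne]

lemma le_withDensity_ball (hp : 0 ≤ p) (hA : 0 ≤ A) (hr : 0 < r)
    (hf : ∀ᵐ y ∂volume.restrict (Metric.ball w r), ENNReal.ofReal A ≤ f y) :
    ENNReal.ofReal (A ^ p * (unitBallVolume N * r ^ N)) ≤
      (volume.withDensity fun y => f y ^ p) (Metric.ball w r) := by
  rw [withDensity_apply _ measurableSet_ball, ENNReal.ofReal_mul (by positivity),
    ← volume_ball_eq w hr, ← ENNReal.ofReal_rpow_of_nonneg hA hp, ← setLIntegral_const]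
  refine lintegral_mono_ae ?_
  filter_upwards [hf] with y hy
  gcongr

lemma ParabolicLowerBound.le_opS_withDensity (hg : ParabolicLowerBound N α g) (hp : 0 ≤ p)
    (hA : 0 ≤ A) (hr : 0 < r) (hτ : 0 < τ)
    (hsub : Metric.ball w r ⊆ Metric.closedBall x (4 * τ ^ (α / 2)))
    (hf : ∀ᵐ y ∂volume.restrict (Metric.ball w r), ENNReal.ofReal A ≤ f y) :
    ENNReal.ofReal (g / (τ ^ (α / 2)) ^ N * (A ^ p * (unitBallVolume N * r ^ N))) ≤
      ENNReal.ofReal α * opS α τ (volume.withDensity fun y => f y ^ p) x := by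
  have hpos := hg.pos
  refine le_trans ?_ (hg.le_opS hτ _ x)
  rw [ENNReal.ofReal_mul (by positivity)]
  gcongr
  exact (le_withDensity_ball hp hA hr hf).trans (measure_mono hsub)

/-- Moving from `x` towards `z` keeps a fixed proportion of a small ball around `x` inside
`B(z, ρ)`. -/
lemma exists_ball_subset_ball_inter_closedBall {E : Type*} [NormedAddCommGroup E] [NormedSpace ℝ E]
    {x z : E} (hr : 0 < r) (hrρ : r ≤ ρ) (hx : x ∈ Metric.ball z ρ) :
    ∃ w, Metric.ball w (r / 2) ⊆ Metric.ball z ρ ∧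
      Metric.ball w (r / 2) ⊆ Metric.closedBall x r := by
  have hρ : 0 < ρ := hr.trans_le hrρ
  have hxz : ‖x - z‖ ≤ ρ := (mem_ball_iff_norm.1 hx).le
  have hcoef : r / (2 * ρ) ≤ 1 := by
    rw [div_le_one (by positivity)]
    linarith
  have hmul : r / (2 * ρ) * ρ = r / 2 := by field_simp
  refine ⟨x - (r / (2 * ρ)) • (x - z), Metric.ball_subset_ball' ?_,
    Metric.ball_subset_closedBall.trans (Metric.closedBall_subset_closedBall' ?_)⟩
  · rw [dist_eq_norm, show x - (r / (2 * ρ)) • (x - z) - z = (1 - r / (2 * ρ)) • (x - z) by module,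
      norm_smul, Real.norm_of_nonneg (by linarith)]
    nlinarith
  · rw [dist_eq_norm, sub_sub_cancel_left, norm_neg, norm_smul, Real.norm_of_nonneg (by positivity)]
    nlinarith [show 0 ≤ r / (2 * ρ) by positivity]

/-- The rate at which the nonlinear term amplifies a lower bound. -/
def reactionConst (N : ℕ) (g : ℝ) : ℝ := g * unitBallVolume N / 2 ^ N

lemma reactionConst_pos (N : ℕ) (hg : 0 < g) : 0 < reactionConst N g := by
  have := unitBallVolume_pos N
  unfold reactionConst
  positivity

lemma ParabolicLowerBound.le_opS_withDensity_of_mem_ball (hg : ParabolicLowerBound N α g)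
    (hp : 0 ≤ p) (hA : 0 ≤ A) (hτ : 0 < τ) (hτρ : τ ^ (α / 2) ≤ ρ) (hx : x ∈ Metric.ball z ρ)
    (hf : ∀ᵐ y ∂volume.restrict (Metric.ball z ρ), ENNReal.ofReal A ≤ f y) :
    ENNReal.ofReal (reactionConst N g * A ^ p) ≤
      ENNReal.ofReal α * opS α τ (volume.withDensity fun y => f y ^ p) x := by
  have hR : 0 < τ ^ (α / 2) := by positivity
  obtain ⟨w, hwz, hwx⟩ := exists_ball_subset_ball_inter_closedBall hR hτρ hx
  have hle := hg.le_opS_withDensity hp hA (half_pos hR) hτ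
    (hwx.trans (Metric.closedBall_subset_closedBall (by linarith)))
    (ae_restrict_of_ae_restrict_of_subset hwz hf)
  convert hle using 2
  rw [reactionConst, div_pow]
  field_simp

end Density

section LowerBounds

variable {N : ℕ} {α g p A T ρ θ t₁ t₂ t' : ℝ} {μ : Measure (EuclideanSpace ℝ (Fin N))}
  {u : ℝ → EuclideanSpace ℝ (Fin N) → ℝ≥0∞} {z : EuclideanSpace ℝ (Fin N)} {I : Set ℝ}
  {r f : ℝ → ℝ}

/-- `u(t, x) ≥ f(t)` for almost all `t ∈ I` and `x ∈ B(z, r(t))`. -/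
def LowerBound (u : ℝ → EuclideanSpace ℝ (Fin N) → ℝ≥0∞) (z : EuclideanSpace ℝ (Fin N))
    (I : Set ℝ) (r f : ℝ → ℝ) : Prop :=
  ∀ᵐ t ∂volume.restrict I, ∀ᵐ x ∂volume.restrict (Metric.ball z (r t)), ENNReal.ofReal (f t) ≤ u t x

lemma LowerBound.mono {J : Set ℝ} {r' f' : ℝ → ℝ} (h : LowerBound u z I r f) (hJ : J ⊆ I)
    (hJm : MeasurableSet J) (hr : ∀ t ∈ J, r' t ≤ r t) (hf : ∀ t ∈ J, f' t ≤ f t) :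
    LowerBound u z J r' f' := by
  filter_upwards [ae_restrict_of_ae_restrict_of_subset hJ h, ae_restrict_mem hJm] with t hut ht
  filter_upwards [ae_restrict_of_ae_restrict_of_subset (Metric.ball_subset_ball (hr t ht)) hut]
    with x hx
  exact (ENNReal.ofReal_le_ofReal (hf t ht)).trans hx

lemma IsSolution.lowerBound_of_le_opP (hu : IsSolution α p T μ u)
    (hI : I ⊆ Ioc 0 T) (hIm : MeasurableSet I)
    (h : ∀ t ∈ I, ∀ x ∈ Metric.ball z (r t), ENNReal.ofReal (f t) ≤ opP α t μ x) :
    LowerBound u z I r f := by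
  filter_upwards [ae_restrict_of_ae_restrict_of_subset hI hu.eq, ae_restrict_mem hIm] with t hut ht
  filter_upwards [ae_restrict_of_ae hut, ae_restrict_mem measurableSet_ball] with x hux hx
  rw [hux]
  exact (h t ht x hx).trans le_self_add

lemma IsSolution.lowerBound_of_le_lintegral (hu : IsSolution α p T μ u) (hI : I ⊆ Ioc 0 T)
    (hIm : MeasurableSet I) {J : ℝ → Set ℝ} {φ : ℝ → ℝ → ℝ≥0∞} (hJ : ∀ t ∈ I, J t ⊆ Ioo 0 t)
    (hφ : ∀ t ∈ I, ∀ x ∈ Metric.ball z (r t), ∀ᵐ s ∂volume.restrict (J t),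
      φ t s ≤ ENNReal.ofReal ((t - s) ^ (α - 1)) *
        (ENNReal.ofReal α * opS α (t - s) (volume.withDensity fun y => u s y ^ p) x))
    (hf : ∀ t ∈ I, ENNReal.ofReal (f t) ≤ ∫⁻ s in J t, φ t s) :
    LowerBound u z I r f := by
  filter_upwards [ae_restrict_of_ae_restrict_of_subset hI hu.eq, ae_restrict_mem hIm] with t hut ht
  filter_upwards [ae_restrict_of_ae hut, ae_restrict_mem measurableSet_ball] with x hux hx
  calc ENNReal.ofReal (f t) ≤ ∫⁻ s in J t, φ t s := hf t ht
    _ ≤ ∫⁻ s in J t, ENNReal.ofReal α * (ENNReal.ofReal ((t - s) ^ (α - 1)) *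
          opS α (t - s) (volume.withDensity fun y => u s y ^ p) x) := by
        simp_rw [mul_left_comm (ENNReal.ofReal α)]
        exact lintegral_mono_ae (hφ t ht x hx)
    _ ≤ ENNReal.ofReal α * ∫⁻ s in Ioo 0 t, ENNReal.ofReal ((t - s) ^ (α - 1)) *
          opS α (t - s) (volume.withDensity fun y => u s y ^ p) x := by
        rw [lintegral_const_mul' _ _ ENNReal.ofReal_ne_top]
        gcongr
        exact hJ t ht
    _ ≤ u t x := by
        rw [hux]
        exact le_add_self

lemma IsSolution.exists_forall_lowerBound_le (hu : IsSolution α p T μ u) (hI : I ⊆ Ioc 0 T)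
    (hIv : volume I ≠ 0) (hρ : 0 < ρ) :
    ∃ M, ∀ B, LowerBound u z I (fun _ => ρ) (fun _ => B) → B ≤ M := by
  by_contra! h
  have hnat : ∀ᵐ t ∂volume.restrict I, ∀ n : ℕ, ∀ᵐ x ∂volume.restrict (Metric.ball z ρ),
      ENNReal.ofReal n ≤ u t x := by
    refine ae_all_iff.2 fun n => ?_
    obtain ⟨B, hB, hnB⟩ := h n
    filter_upwards [hB] with t ht
    filter_upwards [ht] with x hx
    exact (ENNReal.ofReal_le_ofReal hnB.le).trans hx
  have := ae_restrict_neBot.2 hIv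
  have := ae_restrict_neBot.2 (Metric.measure_ball_pos volume z hρ).ne'
  obtain ⟨t, htn, htf⟩ := (hnat.and (ae_restrict_of_ae_restrict_of_subset hI hu.finite)).exists
  obtain ⟨x, hxn, hxf⟩ := ((ae_all_iff.2 htn).and (ae_restrict_of_ae htf)).exists
  obtain ⟨n, hn⟩ := ENNReal.exists_nat_gt hxf.ne
  exact (hxn n).not_gt (by simpa using hn)

lemma IsSolution.lowerBound_cylinder (hu : IsSolution α p T μ u) (hg : ParabolicLowerBound N α g)
    (hα : α ∈ Ioo 0 1) (hp : 0 ≤ p) (hA : 0 ≤ A) (ht₁ : 0 ≤ t₁) (ht₂ : t₂ ≤ T)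
    (hρ : (t₂ - t₁) ^ (α / 2) ≤ ρ) (ht' : t₁ ≤ t')
    (h : LowerBound u z (Ioo t₁ t₂) (fun _ => ρ) (fun _ => A)) :
    LowerBound u z (Ioo t' t₂) (fun _ => ρ)
      (fun _ => reactionConst N g * (t' - t₁) ^ α * A ^ p) := by
  have hα0 := hα.1
  have hκ := reactionConst_pos N hg.pos
  refine hu.lowerBound_of_le_lintegral (J := fun t => Ioo t₁ t)
    (φ := fun t _ => ENNReal.ofReal ((t - t₁) ^ (α - 1) * (reactionConst N g * A ^ p)))
    (fun t ht => ⟨ht₁.trans_lt (ht'.trans_lt ht.1), ht.2.le.trans ht₂⟩) measurableSet_Ioo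
    (fun t _ => Ioo_subset_Ioo_left ht₁) (fun t ht x hx => ?_) (fun t ht => ?_)
  · filter_upwards [ae_restrict_of_ae_restrict_of_subset (Ioo_subset_Ioo_right ht.2.le) h,
      ae_restrict_mem measurableSet_Ioo] with s hus hs
    have hts : 0 < t - s := sub_pos.2 hs.2
    rw [ENNReal.ofReal_mul (Real.rpow_nonneg (by linarith [hs.1]) _)]
    gcongr ?_ * ?_
    · exact ENNReal.ofReal_le_ofReal
        (Real.rpow_le_rpow_of_nonpos hts (by linarith [hs.1]) (by linarith [hα.2]))
    · refine hg.le_opS_withDensity_of_mem_ball hp hA hts (le_trans ?_ hρ) hx hus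
      exact Real.rpow_le_rpow hts.le (by linarith [hs.1, ht.2]) (by positivity)
  · have htt : 0 < t - t₁ := by linarith [ht.1]
    rw [setLIntegral_const, Real.volume_Ioo, ← ENNReal.ofReal_mul (by positivity)]
    refine ENNReal.ofReal_le_ofReal ?_
    calc reactionConst N g * (t' - t₁) ^ α * A ^ p
        ≤ reactionConst N g * (t - t₁) ^ α * A ^ p := by
          gcongr
          exact ht.1.le
      _ = (t - t₁) ^ (α - 1) * (reactionConst N g * A ^ p) * (t - t₁) := by
          rw [Real.rpow_sub_one htt.ne']
          field_simp

/-- The bound for `A^{p-1} (θ - t₁)^α` when a solution is at least `A` on a parabolic cylinder over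
`(t₁, t₂)`, `t₁ ≤ θ < t₂`: the total cost of doubling `A` infinitely often. -/
def cylinderConst (N : ℕ) (g p : ℝ) : ℝ := 2 / reactionConst N g / (1 - 2 ^ (-(p - 1)))

lemma cylinderConst_pos (N : ℕ) (hg : 0 < g) (hp : 1 < p) : 0 < cylinderConst N g p := by
  have := reactionConst_pos N hg
  have : 0 < 1 - (2 : ℝ) ^ (-(p - 1)) :=
    sub_pos.2 (Real.rpow_lt_one_of_one_lt_of_neg one_lt_two (by linarith))
  unfold cylinderConst
  positivity

lemma IsSolution.rpow_mul_le_of_lowerBound_cylinder (hu : IsSolution α p T μ u)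
    (hg : ParabolicLowerBound N α g) (hα : α ∈ Ioo 0 1) (hp : 1 < p) (hA : 0 < A) (ht₁ : 0 ≤ t₁)
    (ht₂ : t₂ ≤ T) (hρ : (t₂ - t₁) ^ (α / 2) ≤ ρ) (hθ : θ ∈ Ico t₁ t₂)
    (h : LowerBound u z (Ioo t₁ t₂) (fun _ => ρ) (fun _ => A)) :
    A ^ (p - 1) * (θ - t₁) ^ α ≤ cylinderConst N g p := by
  have hα0 := hα.1
  have hκ := reactionConst_pos N hg.pos
  have hρ0 : 0 < ρ := (Real.rpow_pos_of_pos (sub_pos.2 (hθ.1.trans_lt hθ.2)) _).trans_le hρ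
  have key := rpow_mul_sub_le_of_doubling (Λ := fun t => (t - t₁) ^ α) (r := p - 1)
    (P := fun t B => LowerBound u z (Ioo t t₂) (fun _ => ρ) (fun _ => B)) (sub_pos.2 hp) hθ.1
    (by positivity : 0 ≤ 2 / reactionConst N g) hA
    ((continuous_sub_right t₁).continuousOn.rpow_const fun _ _ => Or.inr hα0.le)
    (fun t ht t' ht' B hB hPB hcost => ?_) ?_ h
  · simpa only [sub_self, Real.zero_rpow hα0.ne', sub_zero, cylinderConst] using key
  · have hsubadd : (t' - t₁) ^ α - (t - t₁) ^ α ≤ (t' - t) ^ α := by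
      have := Real.rpow_add_le_add_rpow (sub_nonneg.2 ht'.1) (sub_nonneg.2 ht.1) hα0.le hα.2.le
      rw [sub_add_sub_cancel] at this
      linarith
    have htρ : (t₂ - t) ^ (α / 2) ≤ ρ :=
      (Real.rpow_le_rpow (by linarith [ht.2, hθ.2]) (by linarith [ht.1]) (by positivity)).trans hρ
    refine (hu.lowerBound_cylinder hg hα (by linarith) hB.le (ht₁.trans ht.1) ht₂ htρ ht'.1
      hPB).mono subset_rfl measurableSet_Ioo (fun _ _ => le_rfl) fun _ _ => ?_
    calc 2 * B = reactionConst N g * (2 / reactionConst N g) * B := by field_simp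
      _ ≤ reactionConst N g * (B ^ (p - 1) * (t' - t) ^ α) * B := by
          gcongr
          exact hcost.trans (by gcongr)
      _ = reactionConst N g * (t' - t) ^ α * B ^ p := by
          rw [Real.rpow_sub_one hB.ne']
          field_simp
  · obtain ⟨M, hM⟩ := hu.exists_forall_lowerBound_le (z := z) (I := Ioo θ t₂)
      (fun t ht => ⟨ht₁.trans_lt (hθ.1.trans_lt ht.1), ht.2.le.trans ht₂⟩)
      (by simpa using hθ.2) hρ0
    exact ⟨M, fun t ht B hB => hM B (hB.mono (Ioo_subset_Ioo_left ht.2) measurableSet_Ioo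
      (fun _ _ => le_rfl) fun _ _ => le_rfl)⟩

end LowerBounds

section Growth

variable {N : ℕ} {α g p σ t T : ℝ} {μ : Measure (EuclideanSpace ℝ (Fin N))}
  [IsLocallyFiniteMeasure μ] {u : ℝ → EuclideanSpace ℝ (Fin N) → ℝ≥0∞}

lemma rpow_div_le_div_rpow {c β : ℝ} (ht : 0 ≤ t) (hc : 1 ≤ c) (hβ : β ≤ 1) :
    t ^ β / c ≤ (t / c) ^ β := by
  rw [Real.div_rpow ht (by positivity)]
  gcongr
  exact (Real.rpow_le_rpow_of_exponent_le hc hβ).trans_eq (Real.rpow_one c)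

lemma rpow_two_div_rpow_half (hσ : 0 ≤ σ) (hα : α ≠ 0) : (σ ^ (2 / α)) ^ (α / 2) = σ := by
  rw [← inv_div α 2, Real.rpow_inv_rpow hσ (by positivity)]

lemma rpow_two_div_le (hσ : σ ∈ Ioc 0 (T ^ (α / 2))) (hT : 0 < T) (hα : 0 < α) :
    σ ^ (2 / α) ≤ T := by
  rw [← inv_div α 2, Real.rpow_inv_le_iff_of_pos hσ.1.le hT.le (by positivity)]
  exact hσ.2

lemma IsSolution.lowerBound_initial (hu : IsSolution α p T μ u) (hg : ParabolicLowerBound N α g)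
    {I : Set ℝ} (hI : I ⊆ Ioc 0 T) (hIm : MeasurableSet I) {r : ℝ → ℝ}
    (hr : ∀ t ∈ I, σ + r t ≤ 4 * t ^ (α / 2)) (z : EuclideanSpace ℝ (Fin N)) :
    LowerBound u z I r fun t => g / (t ^ (α / 2)) ^ N * μ.real (Metric.ball z σ) := by
  have hpos := hg.pos
  refine hu.lowerBound_of_le_opP hI hIm fun t ht x hx => ?_
  have ht0 : 0 < t := (hI ht).1
  have hsub : Metric.ball z σ ⊆ Metric.closedBall x (4 * t ^ (α / 2)) :=
    Metric.ball_subset_closedBall.trans (Metric.closedBall_subset_closedBall' (by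
      linarith [hr t ht, Metric.mem_ball'.1 hx]))
  refine le_trans ?_ (hg.le_opP ht0 μ x)
  rw [ENNReal.ofReal_mul (by positivity), ofReal_measureReal measure_ball_lt_top.ne]
  gcongr

lemma IsSolution.lowerBound_initial_dyadic (hu : IsSolution α p T μ u)
    (hg : ParabolicLowerBound N α g) (hα : α ∈ Ioo 0 1) (hT : 0 < T)
    (hσ : σ ∈ Ioc 0 (T ^ (α / 2))) (z : EuclideanSpace ℝ (Fin N)) :
    LowerBound u z (Ioo (σ ^ (2 / α) / 2) (σ ^ (2 / α))) (fun _ => σ)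
      (fun _ => g / σ ^ N * μ.real (Metric.ball z σ)) := by
  have hα0 := hα.1
  have hσ0 := hσ.1
  have hpos := hg.pos
  set τ := σ ^ (2 / α)
  have hτ0 : 0 < τ := by positivity
  have hτσ : τ ^ (α / 2) = σ := rpow_two_div_rpow_half hσ0.le hα0.ne'
  have hsub : Ioo (τ / 2) τ ⊆ Ioc 0 T :=
    fun t ht => ⟨by linarith [ht.1], ht.2.le.trans (rpow_two_div_le hσ hT hα0)⟩
  refine (hu.lowerBound_initial hg hsub measurableSet_Ioo (σ := σ) (r := fun _ => σ)
    (fun t ht => ?_) z).mono subset_rfl measurableSet_Ioo (fun _ _ => le_rfl) fun t ht => ?_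
  · have hdiv := rpow_div_le_div_rpow hτ0.le one_le_two (by linarith [hα.2] : α / 2 ≤ 1)
    have hle : (τ / 2) ^ (α / 2) ≤ t ^ (α / 2) := by
      gcongr
      exact ht.1.le
    linarith
  · have ht0 : 0 < t := (hsub ht).1
    have hle : t ^ (α / 2) ≤ σ := by
      rw [← hτσ]
      gcongr
      exact ht.2.le
    gcongr

/-- The constant of the growth bound `μ(B(z, σ)) ≤ γ₁ σ^{N - 2/(p-1)}`. -/
def growthConst (N : ℕ) (p g : ℝ) : ℝ := (4 * cylinderConst N g p) ^ (p - 1)⁻¹ / g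

lemma growthConst_pos (N : ℕ) (hg : 0 < g) (hp : 1 < p) : 0 < growthConst N p g := by
  have := cylinderConst_pos N hg hp
  unfold growthConst
  positivity

lemma IsSolution.measureReal_ball_le (hu : IsSolution α p T μ u) (hg : ParabolicLowerBound N α g)
    (hα : α ∈ Ioo 0 1) (hp : 1 < p) (hT : 0 < T) (hσ : σ ∈ Ioc 0 (T ^ (α / 2)))
    (z : EuclideanSpace ℝ (Fin N)) :
    μ.real (Metric.ball z σ) ≤ growthConst N p g * σ ^ ((N : ℝ) - 2 / (p - 1)) := by
  have hα0 := hα.1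
  have hg0 := hg.pos
  have hσ0 := hσ.1
  have hC := cylinderConst_pos N hg0 hp
  have hinit := hu.lowerBound_initial_dyadic hg hα hT hσ z
  set M := μ.real (Metric.ball z σ)
  rcases (show 0 ≤ M from measureReal_nonneg).eq_or_lt with hM | hM
  · have := growthConst_pos N hg0 hp
    rw [← hM]
    positivity
  set τ := σ ^ (2 / α)
  have hτ0 : 0 < τ := by positivity
  have hτσ : τ ^ (α / 2) = σ := rpow_two_div_rpow_half hσ0.le hα0.ne'
  set Y := g / σ ^ N * M with hY
  have hY0 : 0 < Y := by positivity
  have hcyl : Y ^ (p - 1) * (3 / 4 * τ - τ / 2) ^ α ≤ cylinderConst N g p := by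
    refine hu.rpow_mul_le_of_lowerBound_cylinder hg hα hp hY0 (by positivity)
      (rpow_two_div_le hσ hT hα0) ?_ ⟨by linarith, by linarith⟩ hinit
    exact (Real.rpow_le_rpow (by linarith) (by linarith) (by positivity)).trans_eq hτσ
  have hYp : Y ^ (p - 1) ≤ 4 * cylinderConst N g p / σ ^ 2 := by
    have hσ2 : σ ^ 2 / 4 ≤ (3 / 4 * τ - τ / 2) ^ α := by
      rw [← hτσ, rpow_half_sq hτ0.le, show 3 / 4 * τ - τ / 2 = τ / 4 by ring]
      exact rpow_div_le_div_rpow hτ0.le (by norm_num) hα.2.le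
    rw [le_div_iff₀ (by positivity)]
    have : Y ^ (p - 1) * (σ ^ 2 / 4) ≤ cylinderConst N g p := le_trans (by gcongr) hcyl
    linarith
  calc M = Y * (σ ^ N / g) := by rw [hY]; field_simp
    _ ≤ (4 * cylinderConst N g p / σ ^ 2) ^ (p - 1)⁻¹ * (σ ^ N / g) := by
        gcongr
        exact (Real.le_rpow_inv_iff_of_pos hY0.le (by positivity) (sub_pos.2 hp)).2 hYp
    _ = growthConst N p g * σ ^ ((N : ℝ) - 2 / (p - 1)) := by
        rw [growthConst, Real.div_rpow (by positivity) (by positivity), ← Real.rpow_natCast_mul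
          hσ0.le, Nat.cast_ofNat, ← div_eq_mul_inv, Real.rpow_sub hσ0, Real.rpow_natCast]
        ring

end Growth

section Critical

variable {N : ℕ} {α g A T t t' t'' τ σ : ℝ} {μ : Measure (EuclideanSpace ℝ (Fin N))}
  {u : ℝ → EuclideanSpace ℝ (Fin N) → ℝ≥0∞} {z : EuclideanSpace ℝ (Fin N)}

lemma fujitaExponent_sub_one (N : ℕ) : fujitaExponent N - 1 = 2 / N := add_sub_cancel_left 1 _

lemma one_lt_fujitaExponent (hN : 1 ≤ N) : 1 < fujitaExponent N := by
  have : (0 : ℝ) < N := by exact_mod_cast hN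
  rw [← sub_pos, fujitaExponent_sub_one]
  positivity

lemma pow_rpow_two_div (hN : 1 ≤ N) {r : ℝ} (hr : 0 ≤ r) : (r ^ N) ^ (2 / (N : ℝ)) = r ^ 2 := by
  rw [← Real.rpow_natCast_mul hr, mul_div_cancel₀ _ (by positivity), Real.rpow_ofNat]

lemma pow_rpow_fujitaExponent (hN : 1 ≤ N) {r : ℝ} (hr : 0 < r) :
    (r ^ N) ^ fujitaExponent N = r ^ 2 * r ^ N := by
  rw [fujitaExponent, Real.rpow_add (by positivity), Real.rpow_one, pow_rpow_two_div hN hr.le,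
    mul_comm]

/-- `u(t, x) ≥ A t^{-αN/2}` for almost all `t ∈ (t', T)` and `|x - z| < t^{α/2}`, the profile of the
heat flow of a point mass at `z`. -/
def SelfSimilarLowerBound (u : ℝ → EuclideanSpace ℝ (Fin N) → ℝ≥0∞)
    (z : EuclideanSpace ℝ (Fin N)) (α T t' A : ℝ) : Prop :=
  LowerBound u z (Ioo t' T) (fun t => t ^ (α / 2)) (fun t => A / (t ^ (α / 2)) ^ N)

lemma IsSolution.rpow_le_of_selfSimilarLowerBound
    (hu : IsSolution α (fujitaExponent N) T μ u) (hg : ParabolicLowerBound N α g) (hN : 1 ≤ N)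
    (hα : α ∈ Ioo 0 1) (hT : 0 < T) (hA : 0 < A) (ht' : t' ≤ T / 2)
    (h : SelfSimilarLowerBound u z α T t' A) :
    A ^ (2 / (N : ℝ)) ≤ 4 * cylinderConst N g (fujitaExponent N) := by
  have hα0 := hα.1
  have hsq := rpow_half_sq hT.le α
  set R := T ^ (α / 2)
  have hR : 0 < R := by positivity
  have hcyl : LowerBound u z (Ioo (T / 2) T) (fun _ => (T / 2) ^ (α / 2)) (fun _ => A / R ^ N) := by
    refine h.mono (Ioo_subset_Ioo_left ht') measurableSet_Ioo (fun t ht => ?_) fun t ht => ?_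
    · exact Real.rpow_le_rpow (by positivity) ht.1.le (by positivity)
    · have ht0 : 0 < t := by linarith [ht.1]
      have : t ^ (α / 2) ≤ R := Real.rpow_le_rpow ht0.le ht.2.le (by positivity)
      gcongr
  have key := hu.rpow_mul_le_of_lowerBound_cylinder (θ := 3 / 4 * T) hg hα
    (one_lt_fujitaExponent hN) (by positivity) (by positivity) le_rfl
    (by rw [sub_half]) ⟨by linarith, by linarith⟩ hcyl
  rw [fujitaExponent_sub_one, Real.div_rpow hA.le (by positivity), pow_rpow_two_div hN hR.le, hsq,
    show 3 / 4 * T - T / 2 = T / 4 by ring] at key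
  have hquarter := rpow_div_le_div_rpow hT.le (by norm_num : (1 : ℝ) ≤ 4) hα.2.le
  calc A ^ (2 / (N : ℝ)) = 4 * (A ^ (2 / (N : ℝ)) / T ^ α * (T ^ α / 4)) := by field_simp
    _ ≤ 4 * cylinderConst N g (fujitaExponent N) := by
        gcongr
        exact le_trans (by gcongr) key

lemma ofReal_le_lintegral_rpow_neg {x y : ℝ} (hα : α < 1) (hx : 0 < x) (hy : 0 ≤ y) :
    ENNReal.ofReal ((y ^ (1 - α) - x ^ (1 - α)) / (1 - α)) ≤
      ∫⁻ s in Ioo x y, ENNReal.ofReal (s ^ (-α)) := by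
  rcases le_total y x with hyx | hxy
  · have hle : y ^ (1 - α) ≤ x ^ (1 - α) := Real.rpow_le_rpow hy hyx (by linarith)
    rw [ENNReal.ofReal_of_nonpos (div_nonpos_of_nonpos_of_nonneg (by linarith) (by linarith))]
    exact zero_le
  · have hint : IntegrableOn (fun s : ℝ => s ^ (-α)) (Ioo x y) :=
      ((intervalIntegrable_iff_integrableOn_Ioc_of_le hxy).1
        (intervalIntegral.intervalIntegrable_rpow' (by linarith))).mono_set Ioo_subset_Ioc_self
    have hval := integral_rpow (a := x) (b := y) (r := -α) (Or.inl (by linarith))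
    rw [neg_add_eq_sub] at hval
    rw [← hval, intervalIntegral.integral_of_le hxy, integral_Ioc_eq_integral_Ioo,
      ofReal_integral_eq_lintegral_ofReal hint]
    exact (ae_restrict_iff' measurableSet_Ioo).2 (Eventually.of_forall fun s hs =>
      Real.rpow_nonneg (hx.trans hs.1).le _)

lemma one_sub_le_two_rpow_neg {q : ℝ} (hq : 0 ≤ q) : 1 - q ≤ (2 : ℝ) ^ (-q) := by
  have hlog : Real.log 2 ≤ 1 := Real.log_two_lt_d9.le.trans (by norm_num)
  rw [Real.rpow_def_of_pos two_pos]
  nlinarith [Real.add_one_le_exp (Real.log 2 * -q)]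

lemma one_sub_rpow_div_sub_one_le (hα : α < 1) (ht' : 0 < t') (ht'' : t' ≤ t'') (ht : t'' ≤ t) :
    (1 - (t' / t'') ^ (1 - α)) / (1 - α) - 1 ≤
      t ^ (α - 1) * (((t / 2) ^ (1 - α) - t' ^ (1 - α)) / (1 - α)) := by
  have hq : 0 < 1 - α := sub_pos.2 hα
  have ht''0 : 0 < t'' := ht'.trans_le ht''
  have ht0 : 0 < t := ht''0.trans_le ht
  have hmono : (t' / t) ^ (1 - α) ≤ (t' / t'') ^ (1 - α) := by gcongr
  have htwo := one_sub_le_two_rpow_neg hq.le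
  calc (1 - (t' / t'') ^ (1 - α)) / (1 - α) - 1
      = (1 - (1 - α) - (t' / t'') ^ (1 - α)) / (1 - α) := by field_simp; ring
    _ ≤ (2 ^ (-(1 - α)) - (t' / t) ^ (1 - α)) / (1 - α) := by gcongr
    _ = t ^ (α - 1) * (((t / 2) ^ (1 - α) - t' ^ (1 - α)) / (1 - α)) := by
        rw [← neg_sub 1 α, Real.rpow_neg ht0.le, Real.rpow_neg two_pos.le,
          Real.div_rpow ht0.le two_pos.le, Real.div_rpow ht'.le ht0.le]
        field_simp

lemma ball_rpow_subset_closedBall (hα : α ∈ Ioo 0 1) {s : ℝ} (hs : 0 ≤ s) (hst : s ≤ t / 2)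
    {x : EuclideanSpace ℝ (Fin N)} (hx : x ∈ Metric.ball z (t ^ (α / 2))) :
    Metric.ball z (s ^ (α / 2)) ⊆ Metric.closedBall x (4 * (t - s) ^ (α / 2)) := by
  have hα0 := hα.1
  have ht0 : 0 ≤ t := by linarith
  refine Metric.ball_subset_closedBall.trans (Metric.closedBall_subset_closedBall' ?_)
  have hhalf := rpow_div_le_div_rpow ht0 one_le_two (by linarith [hα.2] : α / 2 ≤ 1)
  have hle : (t / 2) ^ (α / 2) ≤ (t - s) ^ (α / 2) := by gcongr; linarith
  have hr : s ^ (α / 2) ≤ (t / 2) ^ (α / 2) := by gcongr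
  have hts : 0 ≤ (t - s) ^ (α / 2) := Real.rpow_nonneg (by linarith) _
  linarith [Metric.mem_ball'.1 hx]

lemma ParabolicLowerBound.le_opS_selfSimilar (hg : ParabolicLowerBound N α g) (hN : 1 ≤ N)
    (hα : α ∈ Ioo 0 1) (hA : 0 ≤ A) {s : ℝ} (hs : 0 < s) (hst : s ≤ t / 2)
    {x : EuclideanSpace ℝ (Fin N)} (hx : x ∈ Metric.ball z (t ^ (α / 2)))
    {f : EuclideanSpace ℝ (Fin N) → ℝ≥0∞}
    (hf : ∀ᵐ y ∂volume.restrict (Metric.ball z (s ^ (α / 2))),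
      ENNReal.ofReal (A / (s ^ (α / 2)) ^ N) ≤ f y) :
    ENNReal.ofReal (t ^ (α - 1) * (reactionConst N g * A ^ fujitaExponent N / (t ^ (α / 2)) ^ N)) *
        ENNReal.ofReal (s ^ (-α)) ≤
      ENNReal.ofReal ((t - s) ^ (α - 1)) * (ENNReal.ofReal α *
        opS α (t - s) (volume.withDensity fun y => f y ^ fujitaExponent N) x) := by
  have hα0 := hα.1
  have hg0 := hg.pos
  have hκ0 := reactionConst_pos N hg0
  have hV := unitBallVolume_pos N
  have hp : 0 ≤ fujitaExponent N := (zero_lt_one.trans (one_lt_fujitaExponent hN)).le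
  have ht0 : 0 < t := by linarith
  have hts : 0 < t - s := by linarith
  have hR : (t - s) ^ (α / 2) ≤ t ^ (α / 2) := by gcongr; linarith
  refine le_trans ?_ (mul_le_mul_right (hg.le_opS_withDensity hp (by positivity) (by positivity)
    hts (ball_rpow_subset_closedBall hα hs.le hst hx) hf) _)
  rw [← ENNReal.ofReal_mul (by positivity), ← ENNReal.ofReal_mul (by positivity)]
  refine ENNReal.ofReal_le_ofReal ?_
  have hmass : (A / (s ^ (α / 2)) ^ N) ^ fujitaExponent N *
      (unitBallVolume N * (s ^ (α / 2)) ^ N) =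
        A ^ fujitaExponent N * unitBallVolume N * s ^ (-α) := by
    rw [Real.div_rpow hA (by positivity), pow_rpow_fujitaExponent hN (by positivity),
      rpow_half_sq hs.le, Real.rpow_neg hs.le]
    field_simp
  have hκ : reactionConst N g ≤ g * unitBallVolume N :=
    div_le_self (by positivity) (one_le_pow₀ one_le_two)
  have hweight : t ^ (α - 1) ≤ (t - s) ^ (α - 1) :=
    Real.rpow_le_rpow_of_nonpos hts (by linarith) (by linarith [hα.2])
  calc t ^ (α - 1) * (reactionConst N g * A ^ fujitaExponent N / (t ^ (α / 2)) ^ N) * s ^ (-α)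
      ≤ (t - s) ^ (α - 1) *
          (g * unitBallVolume N * A ^ fujitaExponent N / ((t - s) ^ (α / 2)) ^ N) * s ^ (-α) := by
        gcongr
    _ = _ := by
        rw [hmass]
        ring

lemma IsSolution.selfSimilarLowerBound_amplify
    (hu : IsSolution α (fujitaExponent N) T μ u) (hg : ParabolicLowerBound N α g) (hN : 1 ≤ N)
    (hα : α ∈ Ioo 0 1) (hA : 0 ≤ A) (ht' : 0 < t') (ht'' : t' ≤ t'')
    (h : SelfSimilarLowerBound u z α T t' A) :
    SelfSimilarLowerBound u z α T t'' (reactionConst N g * A ^ fujitaExponent N *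
      ((1 - (t' / t'') ^ (1 - α)) / (1 - α) - 1)) := by
  have hκ := reactionConst_pos N hg.pos
  have hpos : ∀ t ∈ Ioo t'' T, 0 < t := fun t ht => (ht'.trans_le ht'').trans ht.1
  refine hu.lowerBound_of_le_lintegral (J := fun t => Ioo t' (t / 2))
    (φ := fun t s => ENNReal.ofReal (t ^ (α - 1) * (reactionConst N g * A ^ fujitaExponent N /
      (t ^ (α / 2)) ^ N)) * ENNReal.ofReal (s ^ (-α)))
    (fun t ht => ⟨hpos t ht, ht.2.le⟩) measurableSet_Ioo
    (fun t ht => Ioo_subset_Ioo ht'.le (half_le_self (hpos t ht).le)) (fun t ht x hx => ?_)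
    (fun t ht => ?_)
  · have hsub : Ioo t' (t / 2) ⊆ Ioo t' T :=
      Ioo_subset_Ioo_right ((half_le_self (hpos t ht).le).trans ht.2.le)
    filter_upwards [ae_restrict_of_ae_restrict_of_subset hsub h, ae_restrict_mem measurableSet_Ioo]
      with s hus hs
    exact hg.le_opS_selfSimilar hN hα hA (ht'.trans hs.1) hs.2.le hx hus
  · have ht0 := hpos t ht
    rw [lintegral_const_mul' _ _ ENNReal.ofReal_ne_top]
    refine le_trans ?_ (mul_le_mul_right
      (ofReal_le_lintegral_rpow_neg hα.2 ht' (half_pos ht0).le) _)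
    rw [← ENNReal.ofReal_mul (by positivity)]
    refine ENNReal.ofReal_le_ofReal ?_
    calc _ ≤ reactionConst N g * A ^ fujitaExponent N *
          (t ^ (α - 1) * (((t / 2) ^ (1 - α) - t' ^ (1 - α)) / (1 - α))) / (t ^ (α / 2)) ^ N := by
          gcongr
          exact one_sub_rpow_div_sub_one_le hα.2 ht' ht'' ht.1.le
      _ = _ := by ring

/-- The bound for the logarithmic growth of a self-similar lower bound: the total cost of doubling
it infinitely often. -/
def criticalConst (N : ℕ) (g : ℝ) : ℝ :=
  (4 * cylinderConst N g (fujitaExponent N) + 2 / reactionConst N g) / (1 - 2 ^ (-(2 / (N : ℝ))))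

lemma criticalConst_pos (hN : 1 ≤ N) (hg : 0 < g) : 0 < criticalConst N g := by
  have := cylinderConst_pos N hg (one_lt_fujitaExponent hN)
  have := reactionConst_pos N hg
  have : 0 < 1 - (2 : ℝ) ^ (-(2 / (N : ℝ))) :=
    sub_pos.2 (Real.rpow_lt_one_of_one_lt_of_neg one_lt_two (neg_lt_zero.2 (by positivity)))
  unfold criticalConst
  positivity

lemma IsSolution.selfSimilarLowerBound_two_mul (hu : IsSolution α (fujitaExponent N) T μ u)
    (hg : ParabolicLowerBound N α g) (hN : 1 ≤ N) (hα : α ∈ Ioo 0 1) (hT : 0 < T) (hA : 0 < A)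
    (ht' : 0 < t') (ht'T : t' ≤ T / 2) (ht'' : t' ≤ t'')
    (hcost : 4 * cylinderConst N g (fujitaExponent N) + 2 / reactionConst N g ≤
      A ^ (2 / (N : ℝ)) * ((1 - (t' / t'') ^ (1 - α)) / (1 - α)))
    (h : SelfSimilarLowerBound u z α T t' A) : SelfSimilarLowerBound u z α T t'' (2 * A) := by
  have hκ := reactionConst_pos N hg.pos
  have hbound := hu.rpow_le_of_selfSimilarLowerBound hg hN hα hT hA ht'T h
  refine (hu.selfSimilarLowerBound_amplify hg hN hα hA.le ht' ht'' h).mono subset_rfl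
    measurableSet_Ioo (fun _ _ => le_rfl) fun t ht => ?_
  have ht0 : 0 < t := (ht'.trans_le ht'').trans ht.1
  refine div_le_div_of_nonneg_right ?_ (by positivity)
  set X := (1 - (t' / t'') ^ (1 - α)) / (1 - α)
  calc 2 * A = reactionConst N g * A * (2 / reactionConst N g) := by field_simp
    _ ≤ reactionConst N g * A * (A ^ (2 / (N : ℝ)) * (X - 1)) := by
        gcongr
        linarith
    _ = reactionConst N g * A ^ fujitaExponent N * (X - 1) := by
        rw [fujitaExponent, Real.rpow_add hA, Real.rpow_one]
        ring

lemma IsSolution.rpow_mul_le_of_selfSimilarLowerBound (hu : IsSolution α (fujitaExponent N) T μ u)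
    (hg : ParabolicLowerBound N α g) (hN : 1 ≤ N) (hα : α ∈ Ioo 0 1) (hτ : 0 < τ)
    (hτT : τ ≤ T / 2) (hA : 0 < A) (h : SelfSimilarLowerBound u z α T τ A) :
    A ^ (2 / (N : ℝ)) * ((1 - (2 * τ / T) ^ (1 - α)) / (1 - α)) ≤ criticalConst N g := by
  have hT : 0 < T := by linarith
  have hq : 0 < 1 - α := sub_pos.2 hα.2
  have hE := cylinderConst_pos N hg.pos (one_lt_fujitaExponent hN)
  have hκ := reactionConst_pos N hg.pos
  have key := rpow_mul_sub_le_of_doubling (Λ := fun t => -((τ / t) ^ (1 - α) / (1 - α)))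
    (P := SelfSimilarLowerBound u z α T) (r := 2 / (N : ℝ)) (by positivity) hτT
    (W := 4 * cylinderConst N g (fujitaExponent N) + 2 / reactionConst N g) (by positivity) hA
    ?_ (fun t ht t' ht' B hB hPB hcost => ?_) ?_ h
  · refine le_trans (le_of_eq ?_) key
    rw [div_self hτ.ne', Real.one_rpow, div_div_eq_mul_div, mul_comm τ 2]
    ring
  · refine ContinuousOn.neg (ContinuousOn.div_const (ContinuousOn.rpow_const
      (continuousOn_const.div continuousOn_id fun t ht => ?_) fun _ _ => Or.inr hq.le) _)
    exact (hτ.trans_le ht.1).ne'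
  · have ht0 : 0 < t := hτ.trans_le ht.1
    have hle : t / t' ≤ 1 := (div_le_one (ht0.trans_le ht'.1)).2 ht'.1
    have hgain : 0 ≤ (1 - (t / t') ^ (1 - α)) / (1 - α) := by
      have := Real.rpow_le_one (div_nonneg ht0.le (ht0.le.trans ht'.1)) hle hq.le
      exact div_nonneg (sub_nonneg.2 this) hq.le
    refine hu.selfSimilarLowerBound_two_mul hg hN hα hT hB ht0 ht.2 ht'.1 (hcost.trans ?_) hPB
    gcongr
    calc -((τ / t') ^ (1 - α) / (1 - α)) - -((τ / t) ^ (1 - α) / (1 - α))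
        = (τ / t) ^ (1 - α) * ((1 - (t / t') ^ (1 - α)) / (1 - α)) := by
          rw [← div_mul_div_cancel₀ ht0.ne' (a := τ) (c := t'), Real.mul_rpow (by positivity)
            (div_nonneg ht0.le (ht0.le.trans ht'.1))]
          ring
      _ ≤ (1 - (t / t') ^ (1 - α)) / (1 - α) :=
          mul_le_of_le_one_left hgain (Real.rpow_le_one (by positivity)
            ((div_le_one ht0).2 ht.1) hq.le)
  · refine ⟨(4 * cylinderConst N g (fujitaExponent N)) ^ (2 / (N : ℝ))⁻¹, fun t ht B hPB => ?_⟩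
    rcases le_or_gt B 0 with hB | hB
    · exact hB.trans (by positivity)
    · exact (Real.le_rpow_inv_iff_of_pos hB.le (by positivity) (by positivity)).2
        (hu.rpow_le_of_selfSimilarLowerBound hg hN hα hT hB ht.2 hPB)

lemma integral_rpow_neg_pos {x y : ℝ} (hx : 0 < x) (hxy : x < y) : 0 < ∫ t in x..y, t ^ (-α) := by
  have h0 : 0 ∉ uIcc x y := notMem_uIcc_of_lt hx (hx.trans hxy)
  exact intervalIntegral.intervalIntegral_pos_of_pos_on
    (intervalIntegral.intervalIntegrable_rpow (Or.inr h0))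
    (fun t ht => Real.rpow_pos_of_pos (hx.trans ht.1) _) hxy

lemma integral_rpow_neg_le (hα : α ∈ Ioo 0 1) (hτ : 0 < τ) (hτT : τ ≤ T) :
    ∫ t in (τ / (16 * T))..(1 / 4), t ^ (-α) ≤ (1 - (2 * τ / T) ^ (1 - α)) / (1 - α) + 7 := by
  have hT : 0 < T := hτ.trans_le hτT
  have hq : 0 < 1 - α := sub_pos.2 hα.2
  have hX : (2 * τ / T) ^ (1 - α) ≤ 8 ^ (1 - α) := by
    gcongr
    rw [div_le_iff₀ hT]
    linarith
  have hscale : τ / (16 * T) = 2 * τ / T / 32 := by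
    field_simp
    norm_num
  have hbernoulli : (8 : ℝ) ^ (1 - α) ≤ 1 + (1 - α) * 7 := by
    have := rpow_one_add_le_one_add_mul_self (s := 7) (by norm_num) hq.le (by linarith [hα.1])
    norm_num at this ⊢
    exact this
  calc ∫ t in (τ / (16 * T))..(1 / 4), t ^ (-α)
      = (8 ^ (1 - α) - (2 * τ / T) ^ (1 - α)) / (1 - α) / 32 ^ (1 - α) := by
        rw [integral_rpow (Or.inl (by linarith [hα.2])), neg_add_eq_sub, hscale,
          show (1 / 4 : ℝ) = 8 / 32 by norm_num, Real.div_rpow (by norm_num) (by norm_num),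
          Real.div_rpow (by positivity) (by norm_num)]
        ring
    _ ≤ (8 ^ (1 - α) - (2 * τ / T) ^ (1 - α)) / (1 - α) :=
        div_le_self (div_nonneg (sub_nonneg.2 hX) hq.le)
          (Real.one_le_rpow (by norm_num) hq.le)
    _ ≤ (1 + (1 - α) * 7 - (2 * τ / T) ^ (1 - α)) / (1 - α) := by gcongr
    _ = (1 - (2 * τ / T) ^ (1 - α)) / (1 - α) + 7 := by
        field_simp
        ring

variable [IsLocallyFiniteMeasure μ]

lemma IsSolution.selfSimilarLowerBound_initial (hu : IsSolution α (fujitaExponent N) T μ u)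
    (hg : ParabolicLowerBound N α g) (hα : α ∈ Ioo 0 1) (hσ : 0 < σ)
    (z : EuclideanSpace ℝ (Fin N)) :
    SelfSimilarLowerBound u z α T (σ ^ (2 / α)) (g * μ.real (Metric.ball z σ)) := by
  have hα0 := hα.1
  have hτ : 0 < σ ^ (2 / α) := by positivity
  have hle : ∀ t ∈ Ioo (σ ^ (2 / α)) T, σ ≤ t ^ (α / 2) := fun t ht => by
    rw [← rpow_two_div_rpow_half hσ.le hα0.ne']
    exact Real.rpow_le_rpow hτ.le ht.1.le (by positivity)
  refine (hu.lowerBound_initial hg (I := Ioo (σ ^ (2 / α)) T) (r := fun t => t ^ (α / 2)) (σ := σ)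
    (fun t ht => ⟨hτ.trans ht.1, ht.2.le⟩) measurableSet_Ioo (fun t ht => ?_) z).mono
    subset_rfl measurableSet_Ioo (fun _ _ => le_rfl) fun _ _ => (div_mul_eq_mul_div _ _ _).ge
  linarith [hle t ht]

lemma IsSolution.rpow_measureReal_ball_mul_le (hu : IsSolution α (fujitaExponent N) T μ u)
    (hg : ParabolicLowerBound N α g) (hN : 1 ≤ N) (hα : α ∈ Ioo 0 1) (hσ : 0 < σ) (hT : 0 < T)
    (z : EuclideanSpace ℝ (Fin N)) :
    (g * μ.real (Metric.ball z σ)) ^ (2 / (N : ℝ)) *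
      ((1 - (2 * σ ^ (2 / α) / T) ^ (1 - α)) / (1 - α)) ≤ criticalConst N g := by
  have hg0 := hg.pos
  have hC := criticalConst_pos hN hg0
  have hM0 : 0 ≤ μ.real (Metric.ball z σ) := measureReal_nonneg
  rcases le_or_gt (σ ^ (2 / α)) (T / 2) with hτT | hτT
  · rcases hM0.eq_or_lt with hM | hM
    · rw [← hM, mul_zero, Real.zero_rpow (by positivity), zero_mul]
      exact hC.le
    · exact hu.rpow_mul_le_of_selfSimilarLowerBound hg hN hα (by positivity) hτT (by positivity)
        (hu.selfSimilarLowerBound_initial hg hα hσ z)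
  · refine (mul_nonpos_of_nonneg_of_nonpos (by positivity) (div_nonpos_of_nonpos_of_nonneg
      (sub_nonpos.2 (Real.one_le_rpow ?_ ?_)) ?_)).trans hC.le
    · rw [one_le_div hT]
      linarith
    all_goals linarith [hα.2]

/-- The constant of the growth bound in the critical case. -/
def criticalGrowthConst (N : ℕ) (g : ℝ) : ℝ :=
  (criticalConst N g / g ^ (2 / (N : ℝ)) +
    7 * growthConst N (fujitaExponent N) g ^ (2 / (N : ℝ))) ^ ((N : ℝ) / 2)

lemma criticalGrowthConst_pos (hN : 1 ≤ N) (hg : 0 < g) : 0 < criticalGrowthConst N g := by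
  have := criticalConst_pos hN hg
  have := growthConst_pos N hg (one_lt_fujitaExponent hN)
  unfold criticalGrowthConst
  positivity

lemma IsSolution.measureReal_ball_le_critical (hu : IsSolution α (fujitaExponent N) T μ u)
    (hg : ParabolicLowerBound N α g) (hN : 1 ≤ N) (hα : α ∈ Ioo 0 1) (hT : 0 < T)
    (hσ : σ ∈ Ioc 0 (T ^ (α / 2))) (z : EuclideanSpace ℝ (Fin N)) :
    μ.real (Metric.ball z σ) ≤ criticalGrowthConst N g *
      (∫ t in (σ ^ (2 / α) / (16 * T))..(1 / 4), t ^ (-α)) ^ (-((N : ℝ) / 2)) := by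
  have hg0 := hg.pos
  have hσ0 := hσ.1
  have hp := one_lt_fujitaExponent hN
  have hC := criticalConst_pos hN hg0
  have hγ := growthConst_pos N hg0 hp
  have hτT : σ ^ (2 / α) ≤ T := rpow_two_div_le hσ hT hα.1
  have hlog := hu.rpow_measureReal_ball_mul_le hg hN hα hσ0 hT z
  have hgrowth := hu.measureReal_ball_le hg hα hp hT hσ z
  rw [fujitaExponent_sub_one, div_div_cancel₀ two_ne_zero, sub_self, Real.rpow_zero, mul_one]
    at hgrowth
  have hIle := integral_rpow_neg_le hα (by positivity) hτT
  have hIpos : 0 < ∫ t in (σ ^ (2 / α) / (16 * T))..(1 / 4), t ^ (-α) := by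
    refine integral_rpow_neg_pos (by positivity) ?_
    rw [div_lt_iff₀ (by positivity)]
    linarith
  have hM : 0 ≤ μ.real (Metric.ball z σ) := measureReal_nonneg
  set M := μ.real (Metric.ball z σ)
  set I := ∫ t in (σ ^ (2 / α) / (16 * T))..(1 / 4), t ^ (-α)
  set X := (1 - (2 * σ ^ (2 / α) / T) ^ (1 - α)) / (1 - α)
  have hMI : M ^ (2 / (N : ℝ)) * I ≤ criticalConst N g / g ^ (2 / (N : ℝ)) +
      7 * growthConst N (fujitaExponent N) g ^ (2 / (N : ℝ)) := by
    calc M ^ (2 / (N : ℝ)) * I ≤ M ^ (2 / (N : ℝ)) * (X + 7) := by gcongr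
      _ = (g * M) ^ (2 / (N : ℝ)) * X / g ^ (2 / (N : ℝ)) + 7 * M ^ (2 / (N : ℝ)) := by
          rw [Real.mul_rpow hg0.le hM]
          field_simp
      _ ≤ _ := by gcongr
  rw [criticalGrowthConst, Real.rpow_neg hIpos.le, ← div_eq_mul_inv,
    ← Real.div_rpow (by positivity) hIpos.le, ← inv_div 2,
    Real.le_rpow_inv_iff_of_pos hM (by positivity) (by positivity)]
  exact (le_div_iff₀ hIpos).2 hMI

end Critical

section Constants

lemma iSup_measure_ball_le {N : ℕ} {μ : Measure (EuclideanSpace ℝ (Fin N))}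
    [IsLocallyFiniteMeasure μ] {σ C : ℝ} (h : ∀ z, μ.real (Metric.ball z σ) ≤ C) :
    ⨆ z, μ (Metric.ball z σ) ≤ ENNReal.ofReal C :=
  iSup_le fun z => (ENNReal.le_ofReal_iff_toReal_le measure_ball_lt_top.ne
    (measureReal_nonneg.trans (h z))).2 (h z)

lemma exists_parabolicLowerBound_eventuallyEq_const (N : ℕ) :
    ∃ g : ℝ → ℝ, (∀ α ∈ Ioo (0 : ℝ) 1, ParabolicLowerBound N α (g α)) ∧
      ∃ g₁ > 0, g =ᶠ[𝓝[<] 1] fun _ => g₁ := by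
  classical
  obtain ⟨g₁, hg₁, hev⟩ := eventually_parabolicLowerBound N
  choose! g hg using fun α (hα : α ∈ Ioo (0 : ℝ) 1) => exists_parabolicLowerBound N hα
  refine ⟨fun α => if ParabolicLowerBound N α g₁ then g₁ else g α, fun α hα => ?_, g₁, hg₁,
    hev.mono fun α h => if_pos h⟩
  dsimp only
  split_ifs with h
  exacts [h, hg α hα]

lemma limsup_coe_mem_Ioo_of_eventuallyEq_const {β : Type*} {l : Filter β} [l.NeBot] {γ : β → ℝ}
    {c : ℝ} (hc : 0 < c) (h : γ =ᶠ[l] fun _ => c) :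
    limsup (fun b => (γ b : EReal)) l ∈ Ioo (0 : EReal) ⊤ := by
  rw [limsup_congr (h.mono fun _ hb => congrArg Real.toEReal hb), limsup_const]
  exact ⟨EReal.coe_pos.2 hc, EReal.coe_lt_top c⟩

end Constants

end

end TimeFractional

theorem theorem1p1 (N : ℕ) (hN : 1 ≤ N) :
    (∀ p : ℝ, 1 < p →
      ∃ γ₁ : ℝ → ℝ,
        (∀ α ∈ Ioo (0 : ℝ) 1, 0 < γ₁ α) ∧
        limsup (fun α => (γ₁ α : EReal)) (𝓝[<] (1 : ℝ)) ∈ Ioo (0 : EReal) ⊤ ∧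
        ∀ α ∈ Ioo (0 : ℝ) 1, ∀ T : ℝ, 0 < T →
          ∀ μ : Measure (EuclideanSpace ℝ (Fin N)), IsLocallyFiniteMeasure μ →
            (∃ u, TimeFractional.IsSolution α p T μ u) →
              ∀ σ ∈ Ioc (0 : ℝ) (T ^ (α / 2)),
                (⨆ z, μ (Metric.ball z σ)) ≤
                  ENNReal.ofReal (γ₁ α * σ ^ ((N : ℝ) - 2 / (p - 1)))) ∧
    (∃ γ₁' : ℝ → ℝ,
        (∀ α ∈ Ioo (0 : ℝ) 1, 0 < γ₁' α) ∧
        limsup (fun α => (γ₁' α : EReal)) (𝓝[<] (1 : ℝ)) ∈ Ioo (0 : EReal) ⊤ ∧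
        ∀ α ∈ Ioo (0 : ℝ) 1, ∀ T : ℝ, 0 < T →
          ∀ μ : Measure (EuclideanSpace ℝ (Fin N)), IsLocallyFiniteMeasure μ →
            (∃ u, TimeFractional.IsSolution α (TimeFractional.fujitaExponent N) T μ u) →
              ∀ σ ∈ Ioc (0 : ℝ) (T ^ (α / 2)),
                (⨆ z, μ (Metric.ball z σ)) ≤
                  ENNReal.ofReal (γ₁' α *
                    (∫ t in (σ ^ (2 / α) / (16 * T))..(1 / 4), t ^ (-α)) ^ (-((N : ℝ) / 2)))) := by
  obtain ⟨g, hg, g₁, hg₁, hev⟩ := TimeFractional.exists_parabolicLowerBound_eventuallyEq_const N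
  refine ⟨fun p hp => ⟨fun α => TimeFractional.growthConst N p (g α), fun α hα => ?_, ?_, ?_⟩,
    fun α => TimeFractional.criticalGrowthConst N (g α), fun α hα => ?_, ?_, ?_⟩
  · exact TimeFractional.growthConst_pos N (hg α hα).pos hp
  · exact TimeFractional.limsup_coe_mem_Ioo_of_eventuallyEq_const
      (TimeFractional.growthConst_pos N hg₁ hp) (hev.fun_comp (TimeFractional.growthConst N p))
  · rintro α hα T hT μ _ ⟨u, hu⟩ σ hσ
    exact TimeFractional.iSup_measure_ball_le fun z =>
      hu.measureReal_ball_le (hg α hα) hα hp hT hσ z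
  · exact TimeFractional.criticalGrowthConst_pos hN (hg α hα).pos
  · exact TimeFractional.limsup_coe_mem_Ioo_of_eventuallyEq_const
      (TimeFractional.criticalGrowthConst_pos hN hg₁)
      (hev.fun_comp (TimeFractional.criticalGrowthConst N))
  · rintro α hα T hT μ _ ⟨u, hu⟩ σ hσ
    exact TimeFractional.iSup_measure_ball_le fun z =>
      hu.measureReal_ball_le_critical (hg α hα) hN hα hT hσ z
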